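/- **Setting.** For each $n$ let $\boldsymbol Y=\boldsymbol X\boldsymbol\beta+\boldsymbol\epsilon\in\mathbb R^n$, where $\boldsymbol X$ is a (fixed) $n\times p$ design matrix, $p=p_n$, $\boldsymbol\beta=\boldsymbol\beta_n\in\mathbb R^p$, and $\epsilon_1,\dots,\epsilon_n$ are i.i.d. $N(0,\sigma^2)$ with $\sigma>0$ not depending on $n$. A model is a subset $M\subseteq\{1,\dots,p\}$; the true model $M_0=\{j:\beta_j\ne0\}$ is nonempty for all large $n$. Let $\boldsymbol H_M$ be the orthogonal projection onto the span of the columns of $\boldsymbol X$ indexed by $M$, $\mathrm{RSS}_M=\|\boldsymbol Y-\boldsymbol H_M\boldsymbol Y\|^2$, $\boldsymbol\mu=\boldsymbol X\boldsymbol\beta$ and $\Delta_M=\|\boldsymbol\mu-\boldsymbol H_M\boldsymbol\mu\|^2$. For a real $\gamma$ put $$R_\gamma(M)=\Gamma\Big(\tfrac{n-|M|}2\Big)\,(\pi\,\mathrm{RSS}_M)^{-\frac{n-|M|-1}2}\,n^{-\frac{|M|+1}2}\binom p{|M|}^{-\gamma}.$$ The generalized fiducial probability over a class of models is $r(M)\propto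 R_\gamma(M)$, normalized to total mass $1$ over that class. Fix $k>1$ and let $\mathcal M=\{M:|M|\le k|M_0|\}$. **Theorem.** Assume that $n\to\infty$, $p\to\infty$, $|M_0|\log p=o(n)$, $\log|M_0|/\log p\to\delta$ with $\delta<1$, $\log n/\log p\to\eta\in\mathbb R$, and that the identifiability condition $$\lim_{n\to\infty}\min\Big\{\frac{\Delta_M}{|M_0|\log p}:\ M_0\not\subset M,\ |M|\le k|M_0|\Big\}=\infty$$ holds. Then there exists $\gamma>\frac{1+\delta}{1-\delta}-\frac{3\eta}{2(1-\delta)}$ such that (a) and (b) below hold. Moreover, (a) and (b) hold for every $\gamma>\frac{1+\delta}{1-\delta}-\frac{\eta}{2(1-\delta)}$. (a) $\displaystyle\max_{M\in\mathcal M,\,M\neq M_0} r(M)/r(M_0)\to0$ in probability. (b) Let $\mathcal M'\subseteq\mathcal M$ be any (possibly data-dependent) class of candidate models satisfying the screening condition: $P(M_0\in\mathcal M')\to1$ and $\log|\mathcal M'_j|=o(j\log n)$ in probability, uniformly in $j$, where $\mathcal M'_j$ is the set of models in $\mathcal M'$ of size $j$. Then, with $r$ normalized over $\mathcal M'$ (and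 $r(M)=0$ for $M\notin\mathcal M'$), $r(M_0)\to1$ in probability; and with probability tending to $1$, $M_0\in\mathcal M'$ and $r(M)<r(M_0)$ for every $M\in\mathcal M'$ with $M\neq M_0$, so the true model is selected. -/

import Mathlib

open Filter Topology MeasureTheory ProbabilityTheory Asymptotics

namespace Fiducial

noncomputable section

variable {n p : ℕ}

/-- The column space of `X_M`, the design matrix restricted to the predictors in `M`. -/
def colSpace (X : Matrix (Fin n) (Fin p) ℝ) (M : Finset (Fin p)) :
    Submodule ℝ (EuclideanSpace ℝ (Fin n)) :=
  Submodule.span ℝ ((fun j => WithLp.toLp 2 (fun i => X i j)) '' (M : Set (Fin p)))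

/-- The projection `H_M` onto the column space of `X_M`; it is given by the matrix
`X_M (X_Mᵀ X_M)⁻¹ X_Mᵀ` when `X_M` has full column rank. -/
def hat (X : Matrix (Fin n) (Fin p) ℝ) (M : Finset (Fin p)) :
    EuclideanSpace ℝ (Fin n) →L[ℝ] EuclideanSpace ℝ (Fin n) :=
  (colSpace X M).starProjection

/-- The residual sum of squares `RSS_M` of the least squares (maximum likelihood) fit of `y`
in the model `M`. -/
def rss (X : Matrix (Fin n) (Fin p) ℝ) (M : Finset (Fin p)) (y : EuclideanSpace ℝ (Fin n)) : ℝ :=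
  ‖y - hat X M y‖ ^ 2

/-- The true model: the set of predictors whose coefficient is nonzero. -/
def trueModel (β : Fin p → ℝ) : Finset (Fin p) :=
  Finset.univ.filter (fun j => β j ≠ 0)

/-- The mean vector `μ = E(Y) = X β`. -/
def mean (X : Matrix (Fin n) (Fin p) ℝ) (β : Fin p → ℝ) : EuclideanSpace ℝ (Fin n) :=
  WithLp.toLp 2 (X.mulVec β)

/-- The response `Y = X β + σ z`. -/
def response (X : Matrix (Fin n) (Fin p) ℝ) (β : Fin p → ℝ) (σ : ℝ) (z : Fin n → ℝ) :
    EuclideanSpace ℝ (Fin n) :=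
  mean X β + σ • WithLp.toLp 2 z

/-- `Δ_M = ‖μ - H_M μ‖²`. -/
def delta (X : Matrix (Fin n) (Fin p) ℝ) (β : Fin p → ℝ) (M : Finset (Fin p)) : ℝ :=
  ‖mean X β - hat X M (mean X β)‖ ^ 2

/-- The class of models of size at most `k |M₀|`. -/
def modelClass (k : ℝ) (M₀ : Finset (Fin p)) : Set (Finset (Fin p)) :=
  {M | (M.card : ℝ) ≤ k * M₀.card}

/-- The minimum of `Δ_M / (|M₀| log p)` over the models `M` with `M₀ ⊄ M` and `|M| ≤ k |M₀|`. -/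
def idGap (k : ℝ) (X : Matrix (Fin n) (Fin p) ℝ) (β : Fin p → ℝ) : ℝ :=
  sInf {t | ∃ M ∈ modelClass k (trueModel β), ¬ trueModel β ⊆ M ∧
    t = delta X β M / ((trueModel β).card * Real.log p)}

/-- The unnormalised generalized fiducial weight `R(M)` with penalty exponent `γ`, at the
observed response `y`. -/
def weight (γ : ℝ) (X : Matrix (Fin n) (Fin p) ℝ) (y : EuclideanSpace ℝ (Fin n))
    (M : Finset (Fin p)) : ℝ :=
  Real.Gamma (((n : ℝ) - M.card) / 2)
    * (Real.pi * rss X M y) ^ (-(((n : ℝ) - M.card - 1) / 2))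
    * (n : ℝ) ^ (-(((M.card : ℝ) + 1) / 2))
    * (p.choose M.card : ℝ) ^ (-γ)

/-- The maximum of `r(M) / r(M₀)` over the models `M ≠ M₀` with `|M| ≤ k |M₀|`.
The normalising constant of `r` cancels. -/
def maxRatio (k γ : ℝ) (X : Matrix (Fin n) (Fin p) ℝ) (y : EuclideanSpace ℝ (Fin n))
    (M₀ : Finset (Fin p)) : ℝ :=
  sSup {t | ∃ M ∈ modelClass k M₀, M ≠ M₀ ∧ t = weight γ X y M / weight γ X y M₀}

/-- The generalized fiducial probability `r(M)` over a finite class `C` of candidate models. -/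
def fidProb (γ : ℝ) (X : Matrix (Fin n) (Fin p) ℝ) (y : EuclideanSpace ℝ (Fin n))
    (C : Finset (Finset (Fin p))) (M : Finset (Fin p)) : ℝ :=
  if M ∈ C then weight γ X y M / ∑ M' ∈ C, weight γ X y M' else 0

end

section Asymptotic

variable {Ω : Type*} [MeasurableSpace Ω]

/-- The class `C` of candidate models, which may depend on the data, consists of models of size
at most `k |M₀|`, contains `M₀` with probability tending to one, and has
`log |C_j| = o(j log n)` in probability, uniformly in the model size `j`. -/
structure ScreeningCondition (P : Measure Ω) (k : ℝ) (p : ℕ → ℕ)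
    (M₀ : ∀ n, Finset (Fin (p n))) (C : ∀ n, Ω → Finset (Finset (Fin (p n)))) : Prop where
  measurable : ∀ n (D : Finset (Finset (Fin (p n)))), MeasurableSet {ω | C n ω = D}
  size_le : ∀ n ω, ∀ M ∈ C n ω, M ∈ modelClass k (M₀ n)
  mem_true : Tendsto (fun n => P {ω | M₀ n ∈ C n ω}) atTop (𝓝 1)
  log_card : ∀ c : ℝ, 0 < c → Tendsto (fun n : ℕ => P {ω | ∀ j : ℕ,
    Real.log (((C n ω).filter (fun M => M.card = j)).card : ℝ) ≤ c * (j * Real.log n)})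
    atTop (𝓝 1)

/-- Consistency of the generalized fiducial distribution with penalty exponent `γ`:
the largest ratio `r(M) / r(M₀)` tends to zero in probability, and over every class of
candidate models satisfying the screening condition `r(M₀)` tends to one in probability, so that
`M₀` is the unique most probable candidate with probability tending to one. -/
def Consistent (P : Measure Ω) (k γ : ℝ) (p : ℕ → ℕ) (X : ∀ n, Matrix (Fin n) (Fin (p n)) ℝ)
    (M₀ : ∀ n, Finset (Fin (p n))) (Y : ∀ n, Ω → EuclideanSpace ℝ (Fin n)) : Prop :=
  TendstoInMeasure P (fun n ω => maxRatio k γ (X n) (Y n ω) (M₀ n)) atTop (fun _ => (0 : ℝ)) ∧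
  ∀ C : ∀ n, Ω → Finset (Finset (Fin (p n))), ScreeningCondition P k p M₀ C →
    TendstoInMeasure P (fun n ω => fidProb γ (X n) (Y n ω) (C n ω) (M₀ n)) atTop
      (fun _ => (1 : ℝ)) ∧
    Tendsto (fun n => P {ω | M₀ n ∈ C n ω ∧ ∀ M ∈ C n ω, M ≠ M₀ n →
      weight γ (X n) (Y n ω) M < weight γ (X n) (Y n ω) (M₀ n)}) atTop (𝓝 1)

end Asymptotic

end Fiducial

namespace Fiducial

/-! ### Gaussian quadratic forms -/

/-! Write s = |M₀| and L = log p. On one event of probability tending to 1, the ratios r(M)/r(M₀) of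
all competitors M in 𝓜 together sum to at most p^(-ε) + e p^(-2) (`sum_weight_div_le`). This gives
(a), and it gives (b) for any data-dependent subclass that contains M₀.

Competitors that strictly contain M₀ and have m extra predictors (`logWeight_sub_le_of_ssubset`):
the Gamma and n factors cost about n^(-m/2) = p^(-mη/2). The binomial penalty costs about
p^(-mγ(1-δ)), because each increment of log C(p,·) near s is close to log p - log s. The gain from
the smaller RSS is about exp(t/2), where t is a χ² variable with at most m degrees of freedom. There
are at most about p^m such models, and exp((1-ε)t/2) has expectation at most ε^(-m/2), so the sum is
small as soon as γ(1-δ) + η/2 > 1.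

Competitors that miss a true predictor (`logWeight_sub_le_of_not_subset`): identifiability makes
RSS_M exceed RSS_{M₀} by a large multiple K of sL. Raised to a power of order n/2, this beats every
other factor, since those are only exp(O(sL)).

The event (`GoodNoise`) asks that ‖z‖² ≈ n and that two weighted sums of exponentials of projected
noise be small. Markov's inequality for such a sum acts as a union bound over all models at once. -/

theorem lintegral_exp_sq_gaussianReal {θ : ℝ} (hθ : θ < 1) :
    ∫⁻ x, ENNReal.ofReal (Real.exp (θ * x ^ 2 / 2)) ∂gaussianReal 0 1
      = ENNReal.ofReal (√(1 - θ))⁻¹ := by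
  have h1 : 0 < (1 - θ) / 2 := by linarith
  rw [gaussianReal_of_var_ne_zero _ one_ne_zero,
    lintegral_withDensity_eq_lintegral_mul _ (measurable_gaussianPDF 0 1) (by fun_prop)]
  have h2 : ∀ x : ℝ, (gaussianPDF 0 1 * fun x => ENNReal.ofReal (Real.exp (θ * x ^ 2 / 2))) x
      = ENNReal.ofReal ((√(2 * Real.pi))⁻¹ * Real.exp (-((1 - θ) / 2) * x ^ 2)) := by
    intro x
    simp only [Pi.mul_apply, gaussianPDF, gaussianPDFReal]
    rw [← ENNReal.ofReal_mul (by positivity), mul_assoc, ← Real.exp_add]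
    congr 3
    · simp
    · simp; ring
  simp_rw [h2]
  rw [← ofReal_integral_eq_lintegral_ofReal ((integrable_exp_neg_mul_sq h1).const_mul _)
    (Eventually.of_forall fun x => by positivity), integral_const_mul, integral_gaussian]
  congr 1
  rw [← Real.sqrt_inv, ← Real.sqrt_inv, ← Real.sqrt_mul (by positivity)]
  congr 1
  have : 1 - θ ≠ 0 := by linarith
  field_simp

section StdGaussian

variable {E : Type*} [NormedAddCommGroup E] [InnerProductSpace ℝ E] [FiniteDimensional ℝ E]
  [MeasurableSpace E] [BorelSpace E]

theorem lintegral_exp_normSq_stdGaussian {θ : ℝ} (hθ : θ < 1) :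
    ∫⁻ x, ENNReal.ofReal (Real.exp (θ * ‖x‖ ^ 2 / 2)) ∂stdGaussian E
      = ENNReal.ofReal (√(1 - θ))⁻¹ ^ Module.finrank ℝ E := by
  rw [stdGaussian, lintegral_map (by fun_prop) (by fun_prop)]
  have h (x : Fin (Module.finrank ℝ E) → ℝ) :
      ENNReal.ofReal (Real.exp (θ * ‖∑ i, x i • stdOrthonormalBasis ℝ E i‖ ^ 2 / 2))
        = ∏ i, ENNReal.ofReal (Real.exp (θ * x i ^ 2 / 2)) := by
    rw [← ENNReal.ofReal_prod_of_nonneg fun i _ => (Real.exp_pos _).le, ← Real.exp_sum,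
      ← Finset.sum_div, ← Finset.mul_sum, ← (stdOrthonormalBasis ℝ E).sum_sq_inner_right]
    congr 5 with i
    rw [(stdOrthonormalBasis ℝ E).orthonormal.inner_right_fintype]
  simp_rw [h]
  have hind := iIndepFun_pi (μ := fun _ : Fin (Module.finrank ℝ E) => gaussianReal 0 1)
    (X := fun _ x => ENNReal.ofReal (Real.exp (θ * x ^ 2 / 2))) fun i => by fun_prop
  rw [lintegral_prod_eq_prod_lintegral_of_indepFun Finset.univ _ hind fun i => by fun_prop]
  have hev (i : Fin (Module.finrank ℝ E)) := (measurePreserving_eval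
    (fun _ : Fin (Module.finrank ℝ E) => gaussianReal 0 1) i).lintegral_comp
    (f := fun x => ENNReal.ofReal (Real.exp (θ * x ^ 2 / 2))) (by fun_prop)
  simp only [Function.eval] at hev
  simp [hev, lintegral_exp_sq_gaussianReal hθ]

/-- The adjoint of the projection is the isometric inclusion of V, so the characteristic function
exp(-‖t‖²/2) restricts to V unchanged. -/
theorem map_orthogonalProjection_stdGaussian (V : Submodule ℝ E) :
    (stdGaussian E).map V.orthogonalProjectionOnto = stdGaussian V := by
  apply Measure.ext_of_charFun
  ext t
  rw [charFun_stdGaussian, charFun_apply, integral_map (by fun_prop) (by fun_prop)]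
  have h (x : E) : inner ℝ (V.orthogonalProjectionOnto x) t = inner ℝ x (t : E) := by
    rw [← Submodule.inner_orthogonalProjectionOnto_eq_of_mem_right]
  simp_rw [h]
  rw [← charFun_apply, charFun_stdGaussian]
  simp

theorem lintegral_exp_starProjection_stdGaussian {θ : ℝ} (hθ : θ < 1) (V : Submodule ℝ E) :
    ∫⁻ x, ENNReal.ofReal (Real.exp (θ * ‖V.starProjection x‖ ^ 2 / 2)) ∂stdGaussian E
      = ENNReal.ofReal (√(1 - θ))⁻¹ ^ Module.finrank ℝ V := by
  rw [← lintegral_exp_normSq_stdGaussian hθ, ← map_orthogonalProjection_stdGaussian V,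
    lintegral_map (by fun_prop) (by fun_prop)]
  rfl

/-- Markov's inequality for a weighted sum of exponentials of Gaussian quadratic forms. -/
theorem stdGaussian_le_sum_exp_starProjection {ι : Type*} (s : Finset ι) (a : ι → ℝ)
    (ha : ∀ i ∈ s, 0 ≤ a i) (V : ι → Submodule ℝ E) (d : ι → ℕ)
    (hd : ∀ i ∈ s, Module.finrank ℝ (V i) ≤ d i) {θ : ℝ} (hθ0 : 0 ≤ θ) (hθ : θ < 1)
    {τ : ℝ} (hτ : 0 < τ) :
    stdGaussian E {x | τ ≤ ∑ i ∈ s, a i * Real.exp (θ * ‖(V i).starProjection x‖ ^ 2 / 2)}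
      ≤ ENNReal.ofReal ((∑ i ∈ s, a i * (√(1 - θ))⁻¹ ^ d i) / τ) := by
  -- A base at least 1 lets the exact dimension in the exponent be replaced by its upper bound `d
  -- i`.
  have hc : 1 ≤ (√(1 - θ))⁻¹ := by
    apply (one_le_inv₀ (Real.sqrt_pos.2 (by linarith))).2
    rw [Real.sqrt_le_one]; linarith
  have h1 : ∫⁻ x, ENNReal.ofReal
      (∑ i ∈ s, a i * Real.exp (θ * ‖(V i).starProjection x‖ ^ 2 / 2)) ∂stdGaussian E
      ≤ ENNReal.ofReal (∑ i ∈ s, a i * (√(1 - θ))⁻¹ ^ d i) := by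
    have h2 (x : E) : ENNReal.ofReal
        (∑ i ∈ s, a i * Real.exp (θ * ‖(V i).starProjection x‖ ^ 2 / 2))
        = ∑ i ∈ s, ENNReal.ofReal (a i) *
          ENNReal.ofReal (Real.exp (θ * ‖(V i).starProjection x‖ ^ 2 / 2)) := by
      rw [ENNReal.ofReal_sum_of_nonneg fun i hi => mul_nonneg (ha i hi) (Real.exp_pos _).le]
      exact Finset.sum_congr rfl fun i hi => ENNReal.ofReal_mul (ha i hi)
    simp_rw [h2]
    rw [lintegral_finsetSum _ fun i _ => by fun_prop,
      ENNReal.ofReal_sum_of_nonneg fun i hi => mul_nonneg (ha i hi) (by positivity)]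
    refine Finset.sum_le_sum fun i hi => ?_
    rw [lintegral_const_mul _ (by fun_prop), lintegral_exp_starProjection_stdGaussian hθ,
      ENNReal.ofReal_mul (ha i hi), ← ENNReal.ofReal_pow (by positivity)]
    gcongr
    exact hd i hi
  have h3 := meas_ge_le_lintegral_div (μ := stdGaussian E) (f := fun x => ENNReal.ofReal
      (∑ i ∈ s, a i * Real.exp (θ * ‖(V i).starProjection x‖ ^ 2 / 2)))
      (Measurable.aemeasurable (by fun_prop)) (ε := ENNReal.ofReal τ) (by simpa using hτ)
      ENNReal.ofReal_ne_top
  rw [ENNReal.ofReal_div_of_pos hτ]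
  refine le_trans (measure_mono fun x hx => ?_) (h3.trans (ENNReal.div_le_div_right h1 _))
  exact ENNReal.ofReal_le_ofReal hx

end StdGaussian

/-- The squared norm of a standard Gaussian vector in `ℝⁿ` is `n (1 + o(1))` in probability. -/
theorem tendsto_stdGaussian_abs_normSq_sub {ε : ℝ} (hε : 0 < ε) :
    Tendsto (fun n : ℕ => stdGaussian (EuclideanSpace ℝ (Fin n))
      {x | ε * n ≤ |‖x‖ ^ 2 - n|}) atTop (𝓝 0) := by
  set v := Var[fun x : ℝ => x ^ 2; gaussianReal 0 1] with hv
  -- Finiteness of the fourth Gaussian moment, needed for Chebyshev's inequality on the sum of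
  -- squares.
  have hL : MemLp (fun x : ℝ => x ^ 2) 2 (gaussianReal 0 1) := by
    have h4 : MemLp (id : ℝ → ℝ) 4 (gaussianReal 0 1) := memLp_id_gaussianReal 4
    have := h4.norm_rpow_div (2 : ENNReal)
    rw [show (4 : ENNReal) / 2 = 2 by
      rw [eq_comm, ENNReal.eq_div_iff (by norm_num) (by norm_num)]; norm_num] at this
    convert this using 2 with x
    simp
  have hm : ∫ x, x ^ 2 ∂gaussianReal 0 1 = 1 := by
    have h := variance_id_gaussianReal (μ := 0) (v := 1)
    rw [variance_eq_integral (by fun_prop)] at h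
    simpa using h
  have hb : ∀ n : ℕ, 0 < n → stdGaussian (EuclideanSpace ℝ (Fin n)) {x | ε * n ≤ |‖x‖ ^ 2 - n|}
      ≤ ENNReal.ofReal (v / ε ^ 2 * (n : ℝ)⁻¹) := by
    intro n hn
    have hn' : (0 : ℝ) < n := by exact_mod_cast hn
    rw [← map_pi_eq_stdGaussian, Measure.map_apply (by fun_prop)
      (measurableSet_le (by fun_prop) (by fun_prop))]
    set μ := Measure.pi (fun _ : Fin n => gaussianReal 0 1) with hμ
    set S : (Fin n → ℝ) → ℝ := ∑ i, fun x => x i ^ 2 with hS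
    have hLi (i : Fin n) : MemLp (fun x : Fin n → ℝ => x i ^ 2) 2 μ :=
      hL.comp_measurePreserving (measurePreserving_eval (fun _ : Fin n => gaussianReal 0 1) i)
    have hSL : MemLp S 2 μ := memLp_finsetSum' _ fun i _ => hLi i
    have hV : Var[S; μ] = n * v := by
      rw [hS, hμ, variance_sum_pi (X := fun _ x => x ^ 2) (fun i => hL)]
      simp [hv]
    have hE : ∫ x, S x ∂μ = n := by
      simp only [hS, Finset.sum_apply]
      rw [integral_finsetSum _ fun i _ => (hLi i).integrable (by norm_num)]
      have (i : Fin n) : ∫ x, x i ^ 2 ∂μ = 1 := by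
        rw [← hm]
        exact integral_comp_eval (μ := fun _ : Fin n => gaussianReal 0 1)
          (f := fun x : ℝ => x ^ 2) (by fun_prop)
      simp [this]
    have h := meas_ge_le_variance_div_sq hSL (c := ε * n) (by positivity)
    rw [hE, hV] at h
    refine le_trans (measure_mono fun x hx => ?_) (h.trans (ENNReal.ofReal_le_ofReal ?_))
    · simpa [hS, EuclideanSpace.real_norm_sq_eq] using hx
    · apply le_of_eq; field_simp
  have ht : Tendsto (fun n : ℕ => ENNReal.ofReal (v / ε ^ 2 * (n : ℝ)⁻¹)) atTop (𝓝 0) := by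
    have := (tendsto_inv_atTop_nhds_zero_nat (𝕜 := ℝ)).const_mul (v / ε ^ 2)
    simpa using ENNReal.tendsto_ofReal this
  exact tendsto_of_tendsto_of_tendsto_of_le_of_le' tendsto_const_nhds ht
    (Eventually.of_forall fun _ => zero_le) ((eventually_gt_atTop 0).mono hb)

/-! ### Projections and residual sums of squares -/

section Projection

variable {E : Type*} [NormedAddCommGroup E] [InnerProductSpace ℝ E] [FiniteDimensional ℝ E]

theorem norm_sub_starProjection_sq (U : Submodule ℝ E) (z : E) :
    ‖z - U.starProjection z‖ ^ 2 = ‖z‖ ^ 2 - ‖U.starProjection z‖ ^ 2 := by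
  have h := U.norm_sq_eq_add_norm_sq_starProjection z
  rw [Submodule.starProjection_orthogonal_val] at h
  linarith

theorem starProjection_sub_starProjection_of_le {U W : Submodule ℝ E} (h : U ≤ W) (z : E) :
    W.starProjection z - U.starProjection z = (Uᗮ ⊓ W).starProjection z := by
  refine (Submodule.eq_starProjection_of_mem_of_inner_eq_zero ?_ ?_).symm
  · refine ⟨?_, W.sub_mem (W.starProjection_apply_mem z) (h (U.starProjection_apply_mem z))⟩
    have h1 : z - U.starProjection z ∈ Uᗮ := U.sub_starProjection_mem_orthogonal z
    have h2 : z - W.starProjection z ∈ Uᗮ :=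
      Submodule.orthogonal_le h (W.sub_starProjection_mem_orthogonal z)
    have := Uᗮ.sub_mem h1 h2
    simpa using this
  · rintro w ⟨hw1, hw2⟩
    rw [show z - (W.starProjection z - U.starProjection z)
      = (z - W.starProjection z) + U.starProjection z by abel, inner_add_left,
      Submodule.inner_left_of_mem_orthogonal hw2 (W.sub_starProjection_mem_orthogonal z),
      Submodule.inner_right_of_mem_orthogonal (U.starProjection_apply_mem z) hw1, add_zero]

theorem norm_starProjection_sq_sub_of_le {U W : Submodule ℝ E} (h : U ≤ W) (z : E) :
    ‖W.starProjection z‖ ^ 2 - ‖U.starProjection z‖ ^ 2 = ‖(Uᗮ ⊓ W).starProjection z‖ ^ 2 := by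
  have h1 : W.starProjection z = U.starProjection z + (Uᗮ ⊓ W).starProjection z := by
    rw [← starProjection_sub_starProjection_of_le h]; abel
  have h2 : inner ℝ (U.starProjection z) ((Uᗮ ⊓ W).starProjection z) = 0 :=
    Submodule.inner_right_of_mem_orthogonal (U.starProjection_apply_mem z)
      ((Uᗮ ⊓ W).starProjection_apply_mem z).1
  rw [h1, norm_add_sq_real, h2]
  ring

theorem norm_starProjection_sq_le_of_le {U W : Submodule ℝ E} (h : U ≤ W) (z : E) :
    ‖U.starProjection z‖ ^ 2 ≤ ‖W.starProjection z‖ ^ 2 := by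
  have := norm_starProjection_sq_sub_of_le h z
  nlinarith [sq_nonneg ‖(Uᗮ ⊓ W).starProjection z‖]

/-- A lower bound for the residual of a noisy signal `m + σ z`, where `U ≤ V` and `m ∈ V`. -/
theorem norm_residual_sq_ge {U V : Submodule ℝ E} (h : U ≤ V) {m : E} (hm : m ∈ V) (σ : ℝ)
    (z : E) :
    σ ^ 2 * ‖z‖ ^ 2 + ‖m - U.starProjection m‖ ^ 2 / 2 - 3 * σ ^ 2 * ‖V.starProjection z‖ ^ 2
      ≤ ‖(m + σ • z) - U.starProjection (m + σ • z)‖ ^ 2 := by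
  set v := m - U.starProjection m with hv
  have hvU : v ∈ Uᗮ := U.sub_starProjection_mem_orthogonal m
  have hvV : v ∈ V := V.sub_mem hm (h (U.starProjection_apply_mem m))
  have e1 : (m + σ • z) - U.starProjection (m + σ • z) = v + σ • (z - U.starProjection z) := by
    rw [map_add, map_smul, hv, smul_sub]; abel
  -- Since v lies in V and is orthogonal to U, the cross term sees only the noise inside V.
  have e2 : inner ℝ v (z - U.starProjection z) = inner ℝ v (V.starProjection z) := by
    rw [inner_sub_right, Submodule.inner_left_of_mem_orthogonal (U.starProjection_apply_mem z) hvU,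
      sub_zero]
    have := Submodule.inner_right_of_mem_orthogonal hvV (V.sub_starProjection_mem_orthogonal z)
    rw [inner_sub_right] at this
    linarith
  rw [e1, norm_add_sq_real, inner_smul_right, e2, norm_smul, mul_pow,
    norm_sub_starProjection_sq U z, Real.norm_eq_abs, sq_abs]
  have h1 := mul_le_mul_of_nonneg_left (norm_starProjection_sq_le_of_le h z) (sq_nonneg σ)
  -- Half of this square bounds the cross term below by -‖v‖²/2 - 2σ²‖P_V z‖². The third σ²‖P_V z‖²
  -- pays for the noise that U absorbs.
  have h2 : 0 ≤ ‖v + (2 * σ) • V.starProjection z‖ ^ 2 := by positivity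
  rw [norm_add_sq_real, inner_smul_right, norm_smul, mul_pow, Real.norm_eq_abs, sq_abs] at h2
  linarith

end Projection

section Rss

variable {n p : ℕ} (X : Matrix (Fin n) (Fin p) ℝ) (β : Fin p → ℝ)

theorem colSpace_mono {M N : Finset (Fin p)} (h : M ⊆ N) : colSpace X M ≤ colSpace X N :=
  Submodule.span_mono (Set.image_mono (by exact_mod_cast h))

theorem mean_mem_colSpace {M : Finset (Fin p)} (h : trueModel β ⊆ M) :
    mean X β ∈ colSpace X M := by
  have : mean X β = ∑ j ∈ trueModel β, β j • WithLp.toLp 2 (fun i => X i j) := by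
    ext i
    rw [WithLp.ofLp_sum, Finset.sum_apply]
    simp only [mean, Matrix.mulVec, dotProduct, trueModel, PiLp.smul_apply, smul_eq_mul]
    rw [Finset.sum_filter]
    refine Finset.sum_congr rfl fun j _ => ?_
    by_cases hj : β j = 0 <;> simp [hj, mul_comm]
  rw [this]
  exact Submodule.sum_mem _ fun j hj => Submodule.smul_mem _ _
    (Submodule.subset_span ⟨j, by exact_mod_cast h hj, rfl⟩)

theorem finrank_colSpace_le (M : Finset (Fin p)) :
    Module.finrank ℝ (colSpace X M) ≤ M.card := by
  classical
  have := finrank_span_finset_le_card (R := ℝ)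
    (M.image fun j => (WithLp.toLp 2 (fun i => X i j) : EuclideanSpace ℝ (Fin n)))
  rw [Finset.coe_image] at this
  exact this.trans Finset.card_image_le

/-- The span of the column space of `X_M` and of the mean vector. -/
noncomputable def signalSpace (M : Finset (Fin p)) : Submodule ℝ (EuclideanSpace ℝ (Fin n)) :=
  colSpace X M ⊔ Submodule.span ℝ {mean X β}

theorem finrank_signalSpace_le (M : Finset (Fin p)) :
    Module.finrank ℝ (signalSpace X β M) ≤ M.card + 1 :=
  (Submodule.finrank_add_le_finrank_add_finrank _ _).trans
    (add_le_add (finrank_colSpace_le X M) (by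
      simpa using finrank_span_le_card (R := ℝ) ({mean X β} : Set (EuclideanSpace ℝ (Fin n)))))

/-- The part of the column space of `X_M` orthogonal to the column space of `X_N`. -/
noncomputable def extraSpace (N M : Finset (Fin p)) : Submodule ℝ (EuclideanSpace ℝ (Fin n)) :=
  (colSpace X N)ᗮ ⊓ colSpace X M

/-- This keeps the degrees of freedom of the RSS drop at the number of added predictors rather than
|M|. -/
theorem finrank_extraSpace_le {N M : Finset (Fin p)} (h : N ⊆ M) :
    Module.finrank ℝ (extraSpace X N M) ≤ (M \ N).card := by
  have h1 := Submodule.finrank_add_inf_finrank_orthogonal (colSpace_mono X h)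
  have h2 : colSpace X M = colSpace X N ⊔ colSpace X (M \ N) := by
    simp only [colSpace]
    rw [← Submodule.span_union, ← Set.image_union, ← Finset.coe_union, Finset.union_sdiff_of_subset h]
  have h3 := Submodule.finrank_add_le_finrank_add_finrank (colSpace X N) (colSpace X (M \ N))
  rw [← h2] at h3
  have h4 := finrank_colSpace_le X (M \ N)
  change Module.finrank ℝ ((colSpace X N)ᗮ ⊓ colSpace X M : Submodule ℝ _) ≤ _
  omega

variable (σ : ℝ) (z : Fin n → ℝ)

theorem rss_response_of_subset {M : Finset (Fin p)} (h : trueModel β ⊆ M) :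
    rss X M (response X β σ z) = σ ^ 2 *
      (‖(WithLp.toLp 2 z : EuclideanSpace ℝ (Fin n))‖ ^ 2
        - ‖(colSpace X M).starProjection (WithLp.toLp 2 z)‖ ^ 2) := by
  have hm := Submodule.starProjection_eq_self_iff.2 (mean_mem_colSpace X β h)
  simp only [rss, response, hat]
  rw [map_add, hm, map_smul, add_sub_add_left_eq_sub, ← smul_sub, norm_smul, mul_pow,
    norm_sub_starProjection_sq, Real.norm_eq_abs, sq_abs]

theorem rss_sub_rss_of_subset {M : Finset (Fin p)} (h : trueModel β ⊆ M) :
    rss X (trueModel β) (response X β σ z) - rss X M (response X β σ z) = σ ^ 2 *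
      ‖(extraSpace X (trueModel β) M).starProjection (WithLp.toLp 2 z)‖ ^ 2 := by
  rw [rss_response_of_subset X β σ z subset_rfl, rss_response_of_subset X β σ z h, extraSpace,
    ← norm_starProjection_sq_sub_of_le (colSpace_mono X h)]
  ring

theorem rss_response_le_of_subset {M : Finset (Fin p)} (h : trueModel β ⊆ M) :
    rss X M (response X β σ z)
      ≤ σ ^ 2 * ‖(WithLp.toLp 2 z : EuclideanSpace ℝ (Fin n))‖ ^ 2 := by
  rw [rss_response_of_subset X β σ z h]
  exact mul_le_mul_of_nonneg_left (sub_le_self _ (sq_nonneg _)) (sq_nonneg _)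

/-- Stated with the larger `signalSpace` so that a single noise bound serves these models and those
missing a true predictor. -/
theorem le_rss_response_of_subset {M : Finset (Fin p)} (h : trueModel β ⊆ M) :
    σ ^ 2 * (‖(WithLp.toLp 2 z : EuclideanSpace ℝ (Fin n))‖ ^ 2
      - ‖(signalSpace X β M).starProjection (WithLp.toLp 2 z)‖ ^ 2)
      ≤ rss X M (response X β σ z) := by
  rw [rss_response_of_subset X β σ z h]
  exact mul_le_mul_of_nonneg_left (sub_le_sub_left
    (norm_starProjection_sq_le_of_le le_sup_left _) _) (sq_nonneg _)

theorem rss_sub_rss_ge (M : Finset (Fin p)) :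
    delta X β M / 2
        - 3 * σ ^ 2 * ‖(signalSpace X β M).starProjection (WithLp.toLp 2 z)‖ ^ 2
      ≤ rss X M (response X β σ z) - rss X (trueModel β) (response X β σ z) := by
  have h1 := norm_residual_sq_ge (U := colSpace X M) (V := signalSpace X β M) le_sup_left
    (Submodule.mem_sup_right (Submodule.mem_span_singleton_self (mean X β))) σ (WithLp.toLp 2 z)
  have h2 := rss_response_le_of_subset X β σ z (subset_refl (trueModel β))
  simp only [delta, rss, response, hat] at *
  linarith

end Rss

/-! ### Gamma function, binomial coefficients, and sums over models -/

/-- By convexity of log Γ, the slope over [y, y + a] lies between those over the adjacent unit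
intervals, which the functional equation evaluates. -/
theorem log_Gamma_slope {y a : ℝ} (hy : 1 < y) (ha : 0 ≤ a) :
    a * Real.log (y - 1) ≤ Real.log (Real.Gamma (y + a)) - Real.log (Real.Gamma y) ∧
      Real.log (Real.Gamma (y + a)) - Real.log (Real.Gamma y) ≤ a * Real.log (y + a) := by
  rcases ha.eq_or_lt with rfl | ha
  · simp
  have step (x : ℝ) (hx : 0 < x) :
      Real.log (Real.Gamma (x + 1)) - Real.log (Real.Gamma x) = Real.log x := by
    rw [Real.Gamma_add_one hx.ne', Real.log_mul hx.ne' (Real.Gamma_pos_of_pos hx).ne']; ring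
  have hconv := Real.convexOn_log_Gamma
  have h1 := hconv.slope_mono_adjacent (x := y - 1) (y := y) (z := y + a)
    (by simp; linarith) (by simp; linarith) (by linarith) (by linarith)
  have h2 := hconv.slope_mono_adjacent (x := y) (y := y + a) (z := y + a + 1)
    (by simp; linarith) (by simp; linarith) (by linarith) (by linarith)
  have s1 := step (y - 1) (by linarith)
  have s2 := step (y + a) (by linarith)
  simp only [Function.comp_apply, sub_sub_cancel, add_sub_cancel_left, div_one] at h1 h2
  rw [sub_add_cancel] at s1
  rw [s1, le_div_iff₀ ha] at h1
  rw [s2, div_le_iff₀ ha] at h2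
  constructor <;> linarith

theorem log_choose_succ {p i : ℕ} (h : i < p) :
    Real.log (p.choose (i + 1)) - Real.log (p.choose i)
      = Real.log ((p : ℝ) - i) - Real.log ((i : ℝ) + 1) := by
  have h1 : (p.choose (i + 1) : ℝ) * ((i : ℝ) + 1) = p.choose i * ((p : ℝ) - i) := by
    have := Nat.choose_succ_right_eq p i
    rw [← Nat.cast_sub h.le]
    exact_mod_cast this
  have c1 : (p.choose (i + 1) : ℝ) ≠ 0 := by exact_mod_cast (Nat.choose_pos h).ne'
  have c2 : (p.choose i : ℝ) ≠ 0 := by exact_mod_cast (Nat.choose_pos h.le).ne'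
  have c3 : (p : ℝ) - i ≠ 0 := by
    have : (i : ℝ) < p := by exact_mod_cast h
    linarith
  have := congrArg Real.log h1
  rw [Real.log_mul c1 (by positivity), Real.log_mul c2 c3] at this
  linarith

theorem log_choose_mem_Icc {p i : ℕ} (h : i ≤ p) :
    0 ≤ Real.log (p.choose i) ∧ Real.log (p.choose i) ≤ i * Real.log p := by
  have c : 1 ≤ p.choose i := Nat.choose_pos h
  refine ⟨Real.log_nonneg (by exact_mod_cast c), ?_⟩
  rw [← Real.log_pow]
  exact Real.log_le_log (by exact_mod_cast c) (by exact_mod_cast Nat.choose_le_pow p i)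

/-- Bounds for the increments of `log (p.choose ·)` between `s` and `s + m`. -/
theorem log_choose_add_sub_mem_Icc {p s m : ℕ} {a b : ℝ} (h : s + m ≤ p)
    (hb : ∀ i, s ≤ i → i < s + m →
      a ≤ Real.log ((p : ℝ) - i) - Real.log ((i : ℝ) + 1) ∧
        Real.log ((p : ℝ) - i) - Real.log ((i : ℝ) + 1) ≤ b) :
    m * a ≤ Real.log (p.choose (s + m)) - Real.log (p.choose s) ∧
      Real.log (p.choose (s + m)) - Real.log (p.choose s) ≤ m * b := by
  induction m with
  | zero => simp
  | succ m ih =>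
    have h1 := ih (by omega) fun i hi1 hi2 => hb i hi1 (by omega)
    have h2 := hb (s + m) (by omega) (by omega)
    rw [← log_choose_succ (by omega : s + m < p)] at h2
    rw [← add_assoc]
    push_cast
    constructor <;> linarith

theorem sum_pow_card_le_exp {p : ℕ} {x : ℝ} (hx : 0 ≤ x) :
    ∑ M : Finset (Fin p), x ^ M.card ≤ Real.exp (p * x) := by
  have h := Finset.sum_pow_mul_eq_add_pow x 1 (Finset.univ : Finset (Fin p))
  simp only [one_pow, mul_one, Finset.powerset_univ, Finset.card_univ, Fintype.card_fin] at h
  rw [h, Real.exp_nat_mul]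
  exact pow_le_pow_left₀ (by linarith) (by linarith [Real.add_one_le_exp x]) _

/-- M ↦ M \ N is injective on strict supersets of N and never empty. Dropping the empty set gives
the -1, which makes the bound vanish as px → 0. -/
theorem sum_pow_card_sdiff_le {p : ℕ} (N : Finset (Fin p)) {x : ℝ} (hx : 0 ≤ x) :
    ∑ M ∈ Finset.univ.filter (fun M => N ⊂ M), x ^ (M \ N).card ≤ Real.exp (p * x) - 1 := by
  have h := sum_pow_card_le_exp (p := p) hx
  rw [← Finset.add_sum_erase _ _ (Finset.mem_univ ∅)] at h
  simp only [Finset.card_empty, pow_zero] at h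
  suffices h2 : ∑ M ∈ Finset.univ.filter (fun M => N ⊂ M), x ^ (M \ N).card
      ≤ ∑ T ∈ Finset.univ.erase (∅ : Finset (Fin p)), x ^ T.card by linarith
  rw [← Finset.sum_image (f := fun T : Finset (Fin p) => x ^ T.card) (g := fun M => M \ N)]
  · refine Finset.sum_le_sum_of_subset_of_nonneg ?_ fun _ _ _ => by positivity
    intro T hT
    obtain ⟨M, hM, rfl⟩ := Finset.mem_image.1 hT
    simp only [Finset.mem_erase, Finset.mem_univ, and_true, ne_eq, Finset.sdiff_eq_empty_iff_subset]
    exact (Finset.mem_filter.1 hM).2.2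
  · intro M hM M' hM' hMM
    have e (K : Finset (Fin p)) (hK : K ∈ Finset.univ.filter (fun M => N ⊂ M)) : N ∪ K \ N = K :=
      Finset.union_sdiff_of_subset (Finset.mem_filter.1 hK).2.1
    rw [← e M (by exact_mod_cast hM), ← e M' (by exact_mod_cast hM')]
    exact congrArg (N ∪ ·) hMM

/-! ### Comparison of the weights of two models -/

section Weight

variable {n p : ℕ} (γ : ℝ) (X : Matrix (Fin n) (Fin p) ℝ) (y : EuclideanSpace ℝ (Fin n))

/-- The logarithm of `weight`, for models of size less than `n` with a positive residual. -/
noncomputable def logWeight (M : Finset (Fin p)) : ℝ :=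
  Real.log (Real.Gamma (((n : ℝ) - M.card) / 2))
    - ((n : ℝ) - M.card - 1) / 2 * Real.log (Real.pi * rss X M y)
    - ((M.card : ℝ) + 1) / 2 * Real.log n - γ * Real.log (p.choose M.card)

theorem card_le_of_finset_fin (M : Finset (Fin p)) : M.card ≤ p := by
  simpa using Finset.card_le_univ M

theorem weight_eq_exp_logWeight {M : Finset (Fin p)} (hM : (M.card : ℝ) < n)
    (hr : 0 < rss X M y) : weight γ X y M = Real.exp (logWeight γ X y M) := by
  have hn : (0 : ℝ) < n := lt_of_le_of_lt (Nat.cast_nonneg _) hM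
  have hc : (0 : ℝ) < p.choose M.card := by
    exact_mod_cast Nat.choose_pos (card_le_of_finset_fin M)
  rw [weight, logWeight, Real.rpow_def_of_pos (by positivity), Real.rpow_def_of_pos hn,
    Real.rpow_def_of_pos hc, ← Real.exp_log (Real.Gamma_pos_of_pos (s := ((n : ℝ) - M.card) / 2)
      (by linarith)), ← Real.exp_add, ← Real.exp_add, ← Real.exp_add, Real.exp_log
      (Real.Gamma_pos_of_pos (by linarith))]
  congr 1
  ring

theorem weight_div_weight {M N : Finset (Fin p)} (hM : (M.card : ℝ) < n) (hN : (N.card : ℝ) < n)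
    (hrM : 0 < rss X M y) (hrN : 0 < rss X N y) :
    weight γ X y M / weight γ X y N = Real.exp (logWeight γ X y M - logWeight γ X y N) := by
  rw [weight_eq_exp_logWeight γ X y hM hrM, weight_eq_exp_logWeight γ X y hN hrN, Real.exp_sub]

/-- The Gamma ratio supplies a power of n/4, which turns RSS_N into RSS_N/n, of constant order. What
remains is n^(-1/2) per added predictor, the binomial penalty, and the RSS drop linearised by log x
≤ x - 1. -/
theorem logWeight_sub_le_of_card_le {M N : Finset (Fin p)} (hc : N.card ≤ M.card)
    (hn : 2 * (M.card : ℝ) + 4 ≤ n) (hrM : 0 < rss X M y) (hr : rss X M y ≤ rss X N y) :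
    logWeight γ X y M - logWeight γ X y N ≤
      ((M.card : ℝ) - N.card) / 2 * (Real.log (4 * Real.pi * (rss X N y / n)) - Real.log n)
      + n / 2 * ((rss X N y - rss X M y) / rss X M y)
      - γ * (Real.log (p.choose M.card) - Real.log (p.choose N.card)) := by
  have hc' : (N.card : ℝ) ≤ M.card := by exact_mod_cast hc
  have hM0 : (0 : ℝ) ≤ M.card := Nat.cast_nonneg _
  have hn0 : (0 : ℝ) < n := by linarith
  have hrN : 0 < rss X N y := hrM.trans_le hr
  have hπ := Real.pi_pos
  have hG := (log_Gamma_slope (y := ((n : ℝ) - M.card) / 2) (a := ((M.card : ℝ) - N.card) / 2)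
    (by linarith) (by linarith)).1
  rw [show ((n : ℝ) - M.card) / 2 + ((M.card : ℝ) - N.card) / 2 = ((n : ℝ) - N.card) / 2 by ring]
    at hG
  have hlog : Real.log ((n : ℝ) / 4) ≤ Real.log (((n : ℝ) - M.card) / 2 - 1) :=
    Real.log_le_log (by positivity) (by linarith)
  have hG' := (mul_le_mul_of_nonneg_left hlog
    (by linarith : 0 ≤ ((M.card : ℝ) - N.card) / 2)).trans hG
  have hR : Real.log (rss X N y) - Real.log (rss X M y)
      ≤ (rss X N y - rss X M y) / rss X M y := by
    rw [← Real.log_div hrN.ne' hrM.ne', sub_div, div_self hrM.ne']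
    exact Real.log_le_sub_one_of_pos (by positivity)
  have hR0 : 0 ≤ (rss X N y - rss X M y) / rss X M y := div_nonneg (by linarith) hrM.le
  have hR' : ((n : ℝ) - M.card - 1) / 2 * (Real.log (rss X N y) - Real.log (rss X M y))
      ≤ n / 2 * ((rss X N y - rss X M y) / rss X M y) :=
    (mul_le_mul_of_nonneg_left hR (by linarith)).trans
      (mul_le_mul_of_nonneg_right (by linarith) hR0)
  have e1 : Real.log (4 * Real.pi * (rss X N y / n))
      = Real.log Real.pi + Real.log (rss X N y) - Real.log ((n : ℝ) / 4) := by
    rw [← Real.log_mul hπ.ne' hrN.ne', ← Real.log_div (by positivity) (by positivity)]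
    congr 1; field_simp
  rw [logWeight, logWeight, e1, Real.log_mul hπ.ne' hrM.ne', Real.log_mul hπ.ne' hrN.ne']
  linarith

/-- The sizes of M and N may be in either order, so all factors except the RSS ratio are bounded
crudely. As e ≤ RSS_N, the log ratio is at least e/(2 RSS_N). Its multiplier is at least n/4, and
RSS_N ≤ cn yields e/(8c). -/
theorem logWeight_sub_le_of_gap {M N : Finset (Fin p)} {D c e : ℝ} (hMD : (M.card : ℝ) ≤ D)
    (hND : (N.card : ℝ) ≤ D) (hn : 2 * D + 4 ≤ n) (hrN : 0 < rss X N y)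
    (hc : rss X N y ≤ c * n) (he : 0 ≤ e) (her : e ≤ rss X N y)
    (hgap : rss X N y + e ≤ rss X M y) :
    logWeight γ X y M - logWeight γ X y N ≤
      D * Real.log n + D / 2 * |Real.log (Real.pi * rss X N y)| + |γ| * (D * Real.log p)
        - e / (8 * c) := by
  have hM0 : (0 : ℝ) ≤ M.card := Nat.cast_nonneg _
  have hN0 : (0 : ℝ) ≤ N.card := Nat.cast_nonneg _
  have hn1 : (1 : ℝ) ≤ n := by linarith
  have hlogn : 0 ≤ Real.log n := Real.log_nonneg hn1
  have hrM : 0 < rss X M y := by linarith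
  have hπ := Real.pi_pos
  have hc0 : 0 < c := by
    by_contra! h
    nlinarith
  have hG : Real.log (Real.Gamma (((n : ℝ) - M.card) / 2))
      - Real.log (Real.Gamma (((n : ℝ) - N.card) / 2)) ≤ D / 2 * Real.log n := by
    rcases le_total N.card M.card with h | h
    · have h' : (N.card : ℝ) ≤ M.card := by exact_mod_cast h
      have hs := (log_Gamma_slope (y := ((n : ℝ) - M.card) / 2)
        (a := ((M.card : ℝ) - N.card) / 2) (by linarith) (by linarith)).1
      rw [show ((n : ℝ) - M.card) / 2 + ((M.card : ℝ) - N.card) / 2 = ((n : ℝ) - N.card) / 2 by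
        ring] at hs
      have : 0 ≤ ((M.card : ℝ) - N.card) / 2 * Real.log (((n : ℝ) - M.card) / 2 - 1) :=
        mul_nonneg (by linarith) (Real.log_nonneg (by linarith))
      have : 0 ≤ D / 2 * Real.log n := mul_nonneg (by linarith) hlogn
      linarith
    · have h' : (M.card : ℝ) ≤ N.card := by exact_mod_cast h
      have hs := (log_Gamma_slope (y := ((n : ℝ) - N.card) / 2)
        (a := ((N.card : ℝ) - M.card) / 2) (by linarith) (by linarith)).2
      rw [show ((n : ℝ) - N.card) / 2 + ((N.card : ℝ) - M.card) / 2 = ((n : ℝ) - M.card) / 2 by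
        ring] at hs
      refine hs.trans (mul_le_mul (by linarith) (Real.log_le_log (by linarith) (by linarith))
        (Real.log_nonneg (by linarith)) (by linarith))
  have hlogs : ((M.card : ℝ) - N.card) / 2 * Real.log (Real.pi * rss X N y)
      ≤ D / 2 * |Real.log (Real.pi * rss X N y)| := by
    refine (le_abs_self _).trans ?_
    rw [abs_mul]
    refine mul_le_mul_of_nonneg_right ?_ (abs_nonneg _)
    rw [abs_le]
    constructor <;> linarith
  have hlogn' : ((N.card : ℝ) - M.card) / 2 * Real.log n ≤ D / 2 * Real.log n :=
    mul_le_mul_of_nonneg_right (by linarith) hlogn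
  have hch : -γ * (Real.log (p.choose M.card) - Real.log (p.choose N.card))
      ≤ |γ| * (D * Real.log p) := by
    have hM1 := log_choose_mem_Icc (card_le_of_finset_fin M)
    have hN1 := log_choose_mem_Icc (card_le_of_finset_fin N)
    have hL : 0 ≤ Real.log p := Real.log_natCast_nonneg p
    have hM2 := mul_le_mul_of_nonneg_right hMD hL
    have hN2 := mul_le_mul_of_nonneg_right hND hL
    refine (le_abs_self _).trans ?_
    rw [abs_mul, abs_neg]
    refine mul_le_mul_of_nonneg_left ?_ (abs_nonneg _)
    rw [abs_le]
    constructor <;> linarith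
  have hmain : e / (8 * c) ≤
      ((n : ℝ) - M.card - 1) / 2 * (Real.log (rss X M y) - Real.log (rss X N y)) := by
    have h1 : e / (2 * rss X N y) ≤ Real.log (rss X M y) - Real.log (rss X N y) := by
      have h2 : Real.log (rss X N y + e) ≤ Real.log (rss X M y) :=
        Real.log_le_log (by linarith) hgap
      have h3 := Real.one_sub_inv_le_log_of_pos
        (show 0 < (rss X N y + e) / rss X N y by positivity)
      rw [Real.log_div (by linarith) hrN.ne'] at h3
      have h4 : e / (2 * rss X N y) ≤ 1 - ((rss X N y + e) / rss X N y)⁻¹ := by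
        rw [inv_div, one_sub_div (by linarith), add_sub_cancel_left]
        exact div_le_div_of_nonneg_left he (by linarith) (by linarith)
      linarith
    have h5 : e / (8 * c) ≤ n / 4 * (e / (2 * rss X N y)) := by
      rw [div_mul_div_comm, div_le_div_iff₀ (by positivity) (by positivity)]
      have := mul_le_mul_of_nonneg_left hc he
      nlinarith
    refine h5.trans (mul_le_mul (by linarith) h1 (by positivity) (by linarith))
  rw [logWeight, logWeight, Real.log_mul hπ.ne' hrM.ne']
  rw [Real.log_mul hπ.ne' hrN.ne'] at hlogs ⊢
  linarith

end Weight

/-! ### The deterministic bound for the sum of all weight ratios -/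

/-- The consequences, for a fixed sample size, of the growth conditions. -/
structure GrowthBounds (k δ η σ ε K : ℝ) (n p s : ℕ) : Prop where
  log_pos : 0 < Real.log p
  one_le : 1 ≤ s
  size : 2 * (k * s) + 4 ≤ n
  noise : 4 * (1 + k) * (s * Real.log p) ≤ ε * n
  gap : K * (s * Real.log p) ≤ σ ^ 2 / 2 * n
  log_lower : (η - ε) * Real.log p ≤ Real.log n
  log_upper : Real.log n ≤ (|η| + 1) * Real.log p
  log_const : Real.log (8 * Real.pi * σ ^ 2) ≤ 2 * ε * Real.log p
  log_const_lower : -Real.log p ≤ Real.log (Real.pi * (σ ^ 2 / 2))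
  log_const_upper : Real.log (Real.pi * (2 * σ ^ 2)) ≤ Real.log p
  choose_incr : ∀ i : ℕ, s ≤ i → (i : ℝ) + 1 ≤ k * s →
    (1 - δ - ε) * Real.log p ≤ Real.log ((p : ℝ) - i) - Real.log ((i : ℝ) + 1) ∧
      Real.log ((p : ℝ) - i) - Real.log ((i : ℝ) + 1) ≤ (1 - δ + ε) * Real.log p

/-- The high-probability event on which the weight of the true model dominates. -/
structure GoodNoise {n p : ℕ} (X : Matrix (Fin n) (Fin p) ℝ) (β : Fin p → ℝ) (ε : ℝ)
    (z : EuclideanSpace ℝ (Fin n)) : Prop where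
  norm_sq : |‖z‖ ^ 2 - n| < ε * n
  signal : ∑ M : Finset (Fin p), Real.exp (-Real.log p) ^ M.card
    * Real.exp (1 / 2 * ‖(signalSpace X β M).starProjection z‖ ^ 2 / 2) < Real.exp (Real.log p)
  extra : ∑ M ∈ Finset.univ.filter (fun M => trueModel β ⊂ M),
    Real.exp (-((1 + ε) * Real.log p)) ^ (M \ trueModel β).card
      * Real.exp ((1 - ε) * ‖(extraSpace X (trueModel β) M).starProjection z‖ ^ 2 / 2) < 1

section Bounds

variable {n p : ℕ} {X : Matrix (Fin n) (Fin p) ℝ} {β : Fin p → ℝ} {k γ δ η σ ε K : ℝ}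
  {z : Fin n → ℝ}

/-- Each term of the positive sum in `signal` is below the bound p; take logarithms. -/
theorem GoodNoise.signal_le (hz : GoodNoise X β ε (WithLp.toLp 2 z)) (M : Finset (Fin p)) :
    ‖(signalSpace X β M).starProjection (WithLp.toLp 2 z)‖ ^ 2
      ≤ 4 * ((1 + M.card) * Real.log p) := by
  have h := (Finset.single_le_sum (f := fun M : Finset (Fin p) => Real.exp (-Real.log p) ^ M.card
    * Real.exp (1 / 2 * ‖(signalSpace X β M).starProjection (WithLp.toLp 2 z)‖ ^ 2 / 2))
    (fun _ _ => by positivity) (Finset.mem_univ M)).trans_lt hz.signal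
  simp only at h
  rw [← Real.exp_nat_mul, ← Real.exp_add, Real.exp_lt_exp] at h
  linarith

theorem GoodNoise.signal_le_of_mem (hz : GoodNoise X β ε (WithLp.toLp 2 z))
    (hg : GrowthBounds k δ η σ ε K n p (trueModel β).card) {M : Finset (Fin p)}
    (hM : M ∈ modelClass k (trueModel β)) :
    ‖(signalSpace X β M).starProjection (WithLp.toLp 2 z)‖ ^ 2
      ≤ 4 * (1 + k) * ((trueModel β).card * Real.log p) := by
  refine (hz.signal_le M).trans ?_
  have h1 : (1 : ℝ) ≤ (trueModel β).card := by exact_mod_cast hg.one_le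
  have hM' : (M.card : ℝ) ≤ k * (trueModel β).card := hM
  have : (1 + (M.card : ℝ)) * Real.log p
      ≤ ((trueModel β).card + k * (trueModel β).card) * Real.log p :=
    mul_le_mul_of_nonneg_right (by linarith) hg.log_pos.le
  linarith

theorem GoodNoise.rss_lower (hz : GoodNoise X β ε (WithLp.toLp 2 z))
    (hg : GrowthBounds k δ η σ ε K n p (trueModel β).card) {M : Finset (Fin p)}
    (hM : M ∈ modelClass k (trueModel β)) (hsub : trueModel β ⊆ M) :
    σ ^ 2 * ((1 - 2 * ε) * n) ≤ rss X M (response X β σ z) := by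
  refine le_trans (mul_le_mul_of_nonneg_left ?_ (sq_nonneg σ))
    (le_rss_response_of_subset X β σ z hsub)
  have h1 := hz.signal_le_of_mem hg hM
  have h2 := (abs_lt.1 hz.norm_sq).1
  have h3 := hg.noise
  linarith

theorem GoodNoise.rss_upper (hz : GoodNoise X β ε (WithLp.toLp 2 z)) (hε : ε ≤ 1)
    {M : Finset (Fin p)} (hsub : trueModel β ⊆ M) :
    rss X M (response X β σ z) ≤ 2 * σ ^ 2 * n := by
  refine (rss_response_le_of_subset X β σ z hsub).trans ?_
  have h2 := (abs_lt.1 hz.norm_sq).2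
  have h3 : ‖(WithLp.toLp 2 z : EuclideanSpace ℝ (Fin n))‖ ^ 2 ≤ 2 * n := by
    have : ε * n ≤ 1 * n := mul_le_mul_of_nonneg_right hε (Nat.cast_nonneg n)
    linarith
  have := mul_le_mul_of_nonneg_left h3 (sq_nonneg σ)
  linarith

theorem GrowthBounds.cast_pos (hg : GrowthBounds k δ η σ ε K n p (trueModel β).card)
    (hk : 1 < k) : (0 : ℝ) < n := by
  have h1 : (1 : ℝ) ≤ (trueModel β).card := by exact_mod_cast hg.one_le
  have := hg.size
  nlinarith

/-- Bounding RSS_M below produces t/2 with factor 1/(1-2ε), while the noise event controls only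
(1-ε)t/2. The excess is O(εt), and t is already O(w). -/
theorem half_div_le {t w : ℝ} (hε : 0 < ε) (hε' : ε ≤ 1 / 10) (ht : 0 ≤ t) (hw : 0 ≤ w)
    (h : (1 - ε) * t / 2 ≤ (1 + ε) * w) :
    t / 2 / (1 - 2 * ε) ≤ (1 - ε) * t / 2 + 5 * ε * w := by
  rw [div_le_iff₀ (by linarith)]
  have h1 : t / 2 ≤ 11 / 9 * w := by nlinarith
  have h2 := mul_le_mul_of_nonneg_left h1 hε.le
  have h3 : ε * (ε * w) ≤ 1 / 10 * (ε * w) := mul_le_mul_of_nonneg_right hε' (by positivity)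
  have h4 : 0 ≤ ε * (ε * t) := by positivity
  have h5 : 0 ≤ ε * w := by positivity
  linarith

/-- The weight ratio of a model strictly containing the true one. -/
theorem logWeight_sub_le_of_ssubset (hσ : 0 < σ) (hk : 1 < k) (hε : 0 < ε) (hε' : ε ≤ 1 / 10)
    (hγ : (9 + |γ|) * ε ≤ γ * (1 - δ) + η / 2 - 1)
    (hg : GrowthBounds k δ η σ ε K n p (trueModel β).card)
    (hz : GoodNoise X β ε (WithLp.toLp 2 z)) {M : Finset (Fin p)}
    (hM : M ∈ modelClass k (trueModel β)) (hsub : trueModel β ⊂ M) :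
    logWeight γ X (response X β σ z) M - logWeight γ X (response X β σ z) (trueModel β)
      ≤ -(ε * Real.log p) + ((M \ trueModel β).card * -((1 + ε) * Real.log p)
        + (1 - ε) * ‖(extraSpace X (trueModel β) M).starProjection (WithLp.toLp 2 z)‖ ^ 2 / 2) := by
  set y := response X β σ z
  set s := (trueModel β).card with hs
  set m := (M \ trueModel β).card with hm
  set t := ‖(extraSpace X (trueModel β) M).starProjection (WithLp.toLp 2 z)‖ ^ 2 with ht
  set L := Real.log p with hL
  have hcard : s + m = M.card := by
    rw [hs, hm, Finset.card_sdiff_of_subset hsub.1]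
    have := Finset.card_le_card hsub.1
    omega
  have hm1 : (1 : ℝ) ≤ m := by
    have := Finset.card_lt_card hsub
    have : 1 ≤ m := by omega
    exact_mod_cast this
  have hcard' : (s : ℝ) + m = M.card := by exact_mod_cast hcard
  have hMk : (M.card : ℝ) ≤ k * s := hM
  have hn0 := hg.cast_pos hk
  have hL0 := hg.log_pos
  have hlow := hz.rss_lower hg hM hsub.1
  have hup := hz.rss_upper (σ := σ) (by linarith : ε ≤ 1) (subset_refl (trueModel β))
  have hdiff := rss_sub_rss_of_subset X β σ z hsub.1
  have ht0 : 0 ≤ t := by positivity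
  have hσ2 : 0 < σ ^ 2 := by positivity
  have hlow0 : 0 < σ ^ 2 * ((1 - 2 * ε) * n) :=
    mul_pos hσ2 (mul_pos (by linarith) hn0)
  have hrM : 0 < rss X M y := hlow0.trans_le hlow
  have hle : rss X M y ≤ rss X (trueModel β) y := by nlinarith
  have h0 := logWeight_sub_le_of_card_le γ X y (Finset.card_le_card hsub.1)
    (by have := hg.size; linarith) hrM hle
  rw [hdiff] at h0
  -- A single term of the sum in `extra` is already below 1.
  have htm : (1 - ε) * t / 2 ≤ (1 + ε) * (m * L) := by
    have h := (Finset.single_le_sum (f := fun M : Finset (Fin p) =>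
      Real.exp (-((1 + ε) * Real.log p)) ^ (M \ trueModel β).card
      * Real.exp ((1 - ε) * ‖(extraSpace X (trueModel β) M).starProjection
        (WithLp.toLp 2 z)‖ ^ 2 / 2))
      (fun _ _ => by positivity)
      (Finset.mem_filter.2 ⟨Finset.mem_univ M, hsub⟩)).trans_lt hz.extra
    simp only at h
    rw [← Real.exp_nat_mul, ← Real.exp_add, Real.exp_lt_one_iff] at h
    linarith
  have hq : (n : ℝ) / 2 * (σ ^ 2 * t / rss X M y) ≤ (1 - ε) * t / 2 + 5 * ε * (m * L) := by
    have h1 : (n : ℝ) / 2 * (σ ^ 2 * t / rss X M y) ≤ t / 2 / (1 - 2 * ε) := by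
      have : σ ^ 2 * t / rss X M y ≤ σ ^ 2 * t / (σ ^ 2 * ((1 - 2 * ε) * n)) :=
        div_le_div_of_nonneg_left (by positivity) hlow0 hlow
      refine (mul_le_mul_of_nonneg_left this (by positivity)).trans (le_of_eq ?_)
      have : 1 - 2 * ε ≠ 0 := by linarith
      field_simp
    exact h1.trans (half_div_le hε hε' ht0 (by positivity) htm)
  have hlogr : Real.log (4 * Real.pi * (rss X (trueModel β) y / n)) ≤ 2 * ε * L := by
    refine le_trans (Real.log_le_log ?_ ?_) hg.log_const
    · have : 0 < rss X (trueModel β) y := hrM.trans_le hle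
      positivity
    · have : rss X (trueModel β) y / n ≤ 2 * σ ^ 2 := by rwa [div_le_iff₀ hn0]
      have := mul_le_mul_of_nonneg_left this (by positivity : 0 ≤ 4 * Real.pi)
      linarith
  have hch := log_choose_add_sub_mem_Icc (p := p) (s := s) (m := m) (a := (1 - δ - ε) * L)
    (b := (1 - δ + ε) * L) (by rw [hcard]; exact card_le_of_finset_fin M) fun i hi1 hi2 =>
      hg.choose_incr i hi1 (by
        have : (i : ℝ) + 1 ≤ s + m := by exact_mod_cast hi2
        linarith)
  rw [hcard] at hch
  have hγc : -γ * (Real.log (p.choose M.card) - Real.log (p.choose s))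
      ≤ -γ * (1 - δ) * (m * L) + |γ| * ε * (m * L) := by
    have h1 : |(Real.log (p.choose M.card) - Real.log (p.choose s)) - (1 - δ) * (m * L)|
        ≤ ε * (m * L) := by
      rw [abs_le]; constructor <;> linarith [hch.1, hch.2]
    have h2 := mul_le_mul_of_nonneg_left h1 (abs_nonneg γ)
    rw [← abs_neg γ, ← abs_mul, abs_neg γ] at h2
    have h3 := (le_abs_self _).trans h2
    linarith only [h3]
  have hlogn : ((M.card : ℝ) - s) / 2 *
      (Real.log (4 * Real.pi * (rss X (trueModel β) y / n)) - Real.log n)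
      ≤ m / 2 * (2 * ε * L - (η - ε) * L) := by
    rw [← hcard', add_sub_cancel_left]
    exact mul_le_mul_of_nonneg_left (by linarith [hg.log_lower]) (by positivity)
  -- Error budget in units of mL: 5ε from the RSS drop, |γ|ε from the binomials, 3ε/2 from log n and
  -- constants, and 2ε for the margins -εL and -εmL. The total stays below (9 + |γ|)ε.
  have hfin := mul_le_mul_of_nonneg_right hγ (by positivity : 0 ≤ m * L)
  have hεmL : ε * L ≤ ε * (m * L) := mul_le_mul_of_nonneg_left (by nlinarith) hε.le
  have hpos : 0 ≤ ε * (m * L) := by positivity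
  linarith only [h0, hq, hγc, hlogn, hfin, hεmL, hpos]

theorem delta_ge_of_idGap_ge {G : ℝ} (hG : G ≤ idGap k X β)
    (hpos : 0 < ((trueModel β).card : ℝ) * Real.log p) {M : Finset (Fin p)}
    (hM : M ∈ modelClass k (trueModel β)) (hsub : ¬ trueModel β ⊆ M) :
    G * ((trueModel β).card * Real.log p) ≤ delta X β M := by
  rw [← le_div_iff₀ hpos]
  refine hG.trans (csInf_le ⟨0, ?_⟩ ⟨M, hM, hsub, rfl⟩)
  rintro _ ⟨N, -, -, rfl⟩
  exact div_nonneg (sq_nonneg _) hpos.le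

theorem mem_modelClass_self (hk : 1 ≤ k) (N : Finset (Fin p)) : N ∈ modelClass k N :=
  le_mul_of_one_le_left (Nat.cast_nonneg _) hk

/-- Half of Δ_M provides (K + 12σ²(1+k))sL, and the projected noise removes at most 3σ² · 4(1+k)sL.
-/
theorem rss_gap (hg : GrowthBounds k δ η σ ε K n p (trueModel β).card)
    (hz : GoodNoise X β ε (WithLp.toLp 2 z))
    (hid : 2 * K + 24 * σ ^ 2 * (1 + k) ≤ idGap k X β) {M : Finset (Fin p)}
    (hM : M ∈ modelClass k (trueModel β)) (hsub : ¬ trueModel β ⊆ M) :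
    rss X (trueModel β) (response X β σ z) + K * ((trueModel β).card * Real.log p)
      ≤ rss X M (response X β σ z) := by
  have h1 : (1 : ℝ) ≤ (trueModel β).card := by exact_mod_cast hg.one_le
  have hd := delta_ge_of_idGap_ge hid (mul_pos (by linarith) hg.log_pos) hM hsub
  have hr := rss_sub_rss_ge X β σ z M
  have hs := mul_le_mul_of_nonneg_left (hz.signal_le_of_mem hg hM) (sq_nonneg σ)
  linarith

/-- The weight ratio of a model that misses a predictor of the true one. -/
theorem logWeight_sub_le_of_not_subset (hσ : 0 < σ) (hk : 1 < k) (hε' : ε ≤ 1 / 10)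
    (hK : K = 16 * σ ^ 2 * (k * (2 * (|η| + 1) + 1 + |γ|) + k + 2))
    (hg : GrowthBounds k δ η σ ε K n p (trueModel β).card)
    (hz : GoodNoise X β ε (WithLp.toLp 2 z))
    (hid : 2 * K + 24 * σ ^ 2 * (1 + k) ≤ idGap k X β) {M : Finset (Fin p)}
    (hM : M ∈ modelClass k (trueModel β)) (hsub : ¬ trueModel β ⊆ M) :
    logWeight γ X (response X β σ z) M - logWeight γ X (response X β σ z) (trueModel β)
      ≤ -(2 * Real.log p) + M.card * -Real.log p := by
  set y := response X β σ z
  set s := (trueModel β).card with hs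
  set L := Real.log p with hL
  have h1 : (1 : ℝ) ≤ s := by exact_mod_cast hg.one_le
  have hMk : (M.card : ℝ) ≤ k * s := hM
  have hL0 := hg.log_pos
  have hn0 := hg.cast_pos hk
  have hM0 := mem_modelClass_self hk.le (trueModel β)
  have hks : (s : ℝ) ≤ k * s := hM0
  have hlow := hz.rss_lower hg hM0 subset_rfl
  have hup := hz.rss_upper (σ := σ) (by linarith : ε ≤ 1) (subset_refl (trueModel β))
  have hlow' : σ ^ 2 / 2 * n ≤ rss X (trueModel β) y := by
    refine le_trans ?_ hlow
    rw [div_mul_eq_mul_div, mul_div_assoc]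
    exact mul_le_mul_of_nonneg_left (by nlinarith) (sq_nonneg σ)
  have hrN : 0 < rss X (trueModel β) y := lt_of_lt_of_le (by positivity) hlow'
  have hK0 : 0 < K := by
    rw [hK]
    have := abs_nonneg η
    have := abs_nonneg γ
    positivity
  have h := logWeight_sub_le_of_gap γ X y hMk hks hg.size hrN hup
    (e := K * (s * L)) (by positivity) (hg.gap.trans hlow') (rss_gap hg hz hid hM hsub)
  have hlogn := hg.log_upper
  have hlogr : |Real.log (Real.pi * rss X (trueModel β) y)| ≤ (|η| + 1) * L + L := by
    have e1 : Real.log (Real.pi * rss X (trueModel β) y)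
        = Real.log n + Real.log (Real.pi * (rss X (trueModel β) y / n)) := by
      rw [← Real.log_mul hn0.ne' (by positivity)]
      congr 1; field_simp
    have hlogn0 : 0 ≤ Real.log n := Real.log_natCast_nonneg n
    have h2 : Real.log (Real.pi * (σ ^ 2 / 2)) ≤ Real.log (Real.pi * (rss X (trueModel β) y / n)) :=
      Real.log_le_log (by positivity) (mul_le_mul_of_nonneg_left
        (by rwa [le_div_iff₀ hn0]) Real.pi_pos.le)
    have h3 : Real.log (Real.pi * (rss X (trueModel β) y / n)) ≤ Real.log (Real.pi * (2 * σ ^ 2)) :=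
      Real.log_le_log (by positivity) (mul_le_mul_of_nonneg_left
        (by rwa [div_le_iff₀ hn0]) Real.pi_pos.le)
    have h4 := hg.log_const_lower
    have h5 := hg.log_const_upper
    have h6 : 0 ≤ (|η| + 1) * L := by positivity
    rw [e1, abs_le]
    constructor <;> linarith
  have hks0 : 0 ≤ k * s := by positivity
  have a1 := mul_le_mul_of_nonneg_left hlogn hks0
  have a2 := mul_le_mul_of_nonneg_left hlogr (by positivity : 0 ≤ k * s / 2)
  -- K carries the factor 16σ² to cancel this denominator. Its bracket pays for the Gamma, n, RSS
  -- and binomial factors, and its last terms k + 2 leave |M|L + 2L.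
  have a3 : K * (s * L) / (8 * (2 * σ ^ 2))
      = (k * (2 * (|η| + 1) + 1 + |γ|) + k + 2) * (s * L) := by
    rw [hK]; field_simp; ring
  rw [a3] at h
  have a4 := mul_le_mul_of_nonneg_right hMk hL0.le
  have a5 := mul_le_mul_of_nonneg_right h1 hL0.le
  have a6 : 0 ≤ (|η| + 1) * (k * s * L) := by positivity
  have a7 : 0 ≤ k * s * L := by positivity
  linarith

theorem rss_pos_of_mem (hσ : 0 < σ) (hk : 1 < k) (hε' : ε ≤ 1 / 10) (hK : 0 ≤ K)
    (hg : GrowthBounds k δ η σ ε K n p (trueModel β).card)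
    (hz : GoodNoise X β ε (WithLp.toLp 2 z))
    (hid : 2 * K + 24 * σ ^ 2 * (1 + k) ≤ idGap k X β) {M : Finset (Fin p)}
    (hM : M ∈ modelClass k (trueModel β)) : 0 < rss X M (response X β σ z) := by
  have hn0 := hg.cast_pos hk
  have hpos : 0 < σ ^ 2 * ((1 - 2 * ε) * n) :=
    mul_pos (by positivity) (mul_pos (by linarith) hn0)
  by_cases hsub : trueModel β ⊆ M
  · exact hpos.trans_le (hz.rss_lower hg hM hsub)
  · have h1 := hpos.trans_le (hz.rss_lower hg (mem_modelClass_self hk.le _) subset_rfl)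
    have h2 : 0 ≤ K * ((trueModel β).card * Real.log p) :=
      mul_nonneg hK (mul_nonneg (Nat.cast_nonneg _) hg.log_pos.le)
    linarith [rss_gap hg hz hid hM hsub]

theorem GrowthBounds.card_lt (hg : GrowthBounds k δ η σ ε K n p (trueModel β).card)
    {M : Finset (Fin p)} (hM : M ∈ modelClass k (trueModel β)) : (M.card : ℝ) < n := by
  have hM' : (M.card : ℝ) ≤ k * (trueModel β).card := hM
  have := hg.size
  have : (0 : ℝ) ≤ M.card := Nat.cast_nonneg _
  linarith

theorem weight_pos_of_mem (hσ : 0 < σ) (hk : 1 < k) (hε' : ε ≤ 1 / 10) (hK : 0 ≤ K)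
    (hg : GrowthBounds k δ η σ ε K n p (trueModel β).card)
    (hz : GoodNoise X β ε (WithLp.toLp 2 z))
    (hid : 2 * K + 24 * σ ^ 2 * (1 + k) ≤ idGap k X β) {M : Finset (Fin p)}
    (hM : M ∈ modelClass k (trueModel β)) : 0 < weight γ X (response X β σ z) M := by
  rw [weight_eq_exp_logWeight γ X _ (hg.card_lt hM) (rss_pos_of_mem hσ hk hε' hK hg hz hid hM)]
  exact Real.exp_pos _

/-- On the good event the true model outweighs all the other models of the class together. -/
theorem sum_weight_div_le (hσ : 0 < σ) (hk : 1 < k) (hε : 0 < ε) (hε' : ε ≤ 1 / 10)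
    (hγ : (9 + |γ|) * ε ≤ γ * (1 - δ) + η / 2 - 1)
    (hK : K = 16 * σ ^ 2 * (k * (2 * (|η| + 1) + 1 + |γ|) + k + 2))
    (hg : GrowthBounds k δ η σ ε K n p (trueModel β).card)
    (hz : GoodNoise X β ε (WithLp.toLp 2 z))
    (hid : 2 * K + 24 * σ ^ 2 * (1 + k) ≤ idGap k X β) (C : Finset (Finset (Fin p)))
    (hC : ∀ M ∈ C, M ∈ modelClass k (trueModel β) ∧ M ≠ trueModel β) :
    ∑ M ∈ C, weight γ X (response X β σ z) M / weight γ X (response X β σ z) (trueModel β)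
      ≤ Real.exp (-(ε * Real.log p)) + Real.exp (1 - 2 * Real.log p) := by
  classical
  set y := response X β σ z with hy
  have hK0 : 0 ≤ K := by
    rw [hK]
    have := abs_nonneg η
    have := abs_nonneg γ
    positivity
  have hM0 := mem_modelClass_self hk.le (trueModel β)
  have hp0 : (0 : ℝ) < p := by
    rcases Nat.eq_zero_or_pos p with h | h
    · have := hg.log_pos
      simp [h] at this
    · exact_mod_cast h
  have hratio (M : Finset (Fin p)) (hM : M ∈ C) :
      weight γ X y M / weight γ X y (trueModel β)
        = Real.exp (logWeight γ X y M - logWeight γ X y (trueModel β)) :=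
    weight_div_weight γ X y (hg.card_lt (hC M hM).1) (hg.card_lt hM0)
      (rss_pos_of_mem hσ hk hε' hK0 hg hz hid (hC M hM).1)
      (rss_pos_of_mem hσ hk hε' hK0 hg hz hid hM0)
  rw [← Finset.sum_filter_add_sum_filter_not C (fun M => trueModel β ⊂ M)]
  refine add_le_add ?_ ?_
  · calc _ ≤ ∑ M ∈ C.filter (fun M => trueModel β ⊂ M), Real.exp (-(ε * Real.log p)) *
          (Real.exp (-((1 + ε) * Real.log p)) ^ (M \ trueModel β).card * Real.exp ((1 - ε)
            * ‖(extraSpace X (trueModel β) M).starProjection (WithLp.toLp 2 z)‖ ^ 2 / 2)) := by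
          refine Finset.sum_le_sum fun M hM => ?_
          obtain ⟨hMC, hsub⟩ := Finset.mem_filter.1 hM
          rw [hratio M hMC, ← Real.exp_nat_mul, ← Real.exp_add, ← Real.exp_add, Real.exp_le_exp]
          exact logWeight_sub_le_of_ssubset hσ hk hε hε' hγ hg hz (hC M hMC).1 hsub
      _ ≤ Real.exp (-(ε * Real.log p)) * 1 := by
          rw [← Finset.mul_sum]
          refine mul_le_mul_of_nonneg_left ?_ (Real.exp_pos _).le
          refine le_trans (Finset.sum_le_sum_of_subset_of_nonneg ?_ fun _ _ _ => by positivity)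
            hz.extra.le
          exact Finset.filter_subset_filter _ (Finset.subset_univ C)
      _ = _ := mul_one _
  · calc _ ≤ ∑ M ∈ C.filter (fun M => ¬ trueModel β ⊂ M), Real.exp (-(2 * Real.log p)) *
          Real.exp (-Real.log p) ^ M.card := by
          refine Finset.sum_le_sum fun M hM => ?_
          obtain ⟨hMC, hsub⟩ := Finset.mem_filter.1 hM
          rw [hratio M hMC, ← Real.exp_nat_mul, ← Real.exp_add, Real.exp_le_exp]
          refine logWeight_sub_le_of_not_subset hσ hk hε' hK hg hz hid (hC M hMC).1 fun h => ?_
          exact hsub (Finset.ssubset_iff_subset_ne.2 ⟨h, (hC M hMC).2.symm⟩)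
      _ ≤ Real.exp (-(2 * Real.log p)) * Real.exp 1 := by
          rw [← Finset.mul_sum]
          refine mul_le_mul_of_nonneg_left ?_ (Real.exp_pos _).le
          refine le_trans (Finset.sum_le_sum_of_subset_of_nonneg (Finset.subset_univ _)
            fun _ _ _ => by positivity) ((sum_pow_card_le_exp (Real.exp_pos _).le).trans ?_)
          rw [Real.exp_le_exp, Real.exp_neg, Real.exp_log hp0, mul_inv_cancel₀ hp0.ne']
      _ = _ := by rw [← Real.exp_add]; congr 1; ring

end Bounds

/-! ### The good event has high probability -/

theorem stdGaussian_not_goodNoise_le {n p : ℕ} (X : Matrix (Fin n) (Fin p) ℝ) (β : Fin p → ℝ)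
    {ε : ℝ} (hε : 0 < ε) (hε' : ε ≤ 1) (hp : 0 < p) :
    stdGaussian (EuclideanSpace ℝ (Fin n)) {z | ¬ GoodNoise X β ε z}
      ≤ stdGaussian (EuclideanSpace ℝ (Fin n)) {z | ε * n ≤ |‖z‖ ^ 2 - n|}
        + (ENNReal.ofReal ((√(1 - 1 / 2))⁻¹ * Real.exp (√(1 - 1 / 2))⁻¹
            * Real.exp (-Real.log p))
          + ENNReal.ofReal
            (Real.exp ((√(1 - (1 - ε)))⁻¹ * Real.exp (-(ε * Real.log p))) - 1)) := by
  have hp' : (0 : ℝ) < p := by exact_mod_cast hp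
  -- The weights p^(-|M|) offset the number of models, so the expected sum stays bounded, and
  -- Markov's inequality at level p gives O(1/p).
  have h2 := stdGaussian_le_sum_exp_starProjection (E := EuclideanSpace ℝ (Fin n))
    (Finset.univ : Finset (Finset (Fin p))) (fun M => Real.exp (-Real.log p) ^ M.card)
    (fun _ _ => by positivity) (signalSpace X β) (fun M => M.card + 1)
    (fun M _ => finrank_signalSpace_le X β M) (θ := 1 / 2) (by norm_num) (by norm_num)
    (Real.exp_pos (Real.log p))
  -- With the extra p^(-ε) per added predictor, the expected sum is at most exp(ε^(-1/2) p^(-ε)) -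
  -- 1, which tends to 0.
  have h3 := stdGaussian_le_sum_exp_starProjection (E := EuclideanSpace ℝ (Fin n))
    (Finset.univ.filter (fun M => trueModel β ⊂ M))
    (fun M => Real.exp (-((1 + ε) * Real.log p)) ^ (M \ trueModel β).card)
    (fun _ _ => by positivity) (extraSpace X (trueModel β)) (fun M => (M \ trueModel β).card)
    (fun M hM => finrank_extraSpace_le X (Finset.mem_filter.1 hM).2.1) (θ := 1 - ε)
    (by linarith) (by linarith) one_pos
  have h2' : (∑ M : Finset (Fin p), Real.exp (-Real.log p) ^ M.card
      * (√(1 - 1 / 2))⁻¹ ^ (M.card + 1)) / Real.exp (Real.log p)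
      ≤ (√(1 - 1 / 2))⁻¹ * Real.exp (√(1 - 1 / 2))⁻¹ * Real.exp (-Real.log p) := by
    set c := (√(1 - 1 / 2 : ℝ))⁻¹
    have hc : 0 ≤ c := by positivity
    have e (M : Finset (Fin p)) : Real.exp (-Real.log p) ^ M.card * c ^ (M.card + 1)
        = c * (Real.exp (-Real.log p) * c) ^ M.card := by ring
    rw [Real.exp_neg (Real.log p), ← div_eq_mul_inv, ← Real.exp_neg (Real.log p)]
    simp_rw [e]
    rw [← Finset.mul_sum]
    gcongr
    refine (sum_pow_card_le_exp (by positivity)).trans (le_of_eq ?_)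
    rw [Real.exp_neg, Real.exp_log hp', mul_inv_cancel_left₀ hp'.ne']
  have h3' : (∑ M ∈ Finset.univ.filter (fun M => trueModel β ⊂ M),
      Real.exp (-((1 + ε) * Real.log p)) ^ (M \ trueModel β).card
        * (√(1 - (1 - ε)))⁻¹ ^ (M \ trueModel β).card) / 1
      ≤ Real.exp ((√(1 - (1 - ε)))⁻¹ * Real.exp (-(ε * Real.log p))) - 1 := by
    rw [div_one]
    simp_rw [← mul_pow]
    refine (sum_pow_card_sdiff_le _ (by positivity)).trans (le_of_eq ?_)
    rw [show -((1 + ε) * Real.log p) = -Real.log p + -(ε * Real.log p) by ring, Real.exp_add,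
      Real.exp_neg (Real.log p), Real.exp_log hp', mul_assoc, mul_inv_cancel_left₀ hp'.ne',
      mul_comm]
  refine le_trans (measure_mono (t := _ ∪ (_ ∪ _)) fun z hz => ?_)
    ((measure_union_le _ _).trans (add_le_add le_rfl ((measure_union_le _ _).trans
      (add_le_add (h2.trans (ENNReal.ofReal_le_ofReal h2'))
        (h3.trans (ENNReal.ofReal_le_ofReal h3'))))))
  by_contra hcon
  simp only [Set.mem_union, not_or] at hcon
  exact hz ⟨not_le.1 hcon.1, not_le.1 hcon.2.1, not_le.1 hcon.2.2⟩

theorem tendsto_stdGaussian_not_goodNoise {p : ℕ → ℕ} (hp : Tendsto p atTop atTop)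
    (X : ∀ n, Matrix (Fin n) (Fin (p n)) ℝ) (β : ∀ n, Fin (p n) → ℝ) {ε : ℝ} (hε : 0 < ε)
    (hε' : ε ≤ 1) :
    Tendsto (fun n => stdGaussian (EuclideanSpace ℝ (Fin n))
      {z | ¬ GoodNoise (X n) (β n) ε z}) atTop (𝓝 0) := by
  have hL : Tendsto (fun n => Real.log (p n)) atTop atTop :=
    Real.tendsto_log_atTop.comp (tendsto_natCast_atTop_atTop.comp hp)
  have t1 : Tendsto (fun n => Real.exp (-Real.log (p n))) atTop (𝓝 0) :=
    Real.tendsto_exp_neg_atTop_nhds_zero.comp hL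
  have t2 : Tendsto (fun n => Real.exp (-(ε * Real.log (p n)))) atTop (𝓝 0) :=
    Real.tendsto_exp_neg_atTop_nhds_zero.comp (hL.const_mul_atTop hε)
  have t1' := ENNReal.tendsto_ofReal
    (t1.const_mul ((√(1 - 1 / 2 : ℝ))⁻¹ * Real.exp (√(1 - 1 / 2 : ℝ))⁻¹))
  have t2' := ENNReal.tendsto_ofReal (((Real.continuous_exp.tendsto _).comp
    (t2.const_mul (√(1 - (1 - ε)))⁻¹)).sub_const 1)
  have t := (tendsto_stdGaussian_abs_normSq_sub hε).add (t1'.add t2')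
  simp only [mul_zero, Real.exp_zero, sub_self, ENNReal.ofReal_zero, add_zero] at t
  refine tendsto_of_tendsto_of_tendsto_of_le_of_le' tendsto_const_nhds t
    (Eventually.of_forall fun _ => zero_le) ?_
  filter_upwards [hp.eventually_gt_atTop 0] with n hn
  exact stdGaussian_not_goodNoise_le (X n) (β n) hε hε' hn

/-! ### The growth conditions -/

theorem eventually_growthBounds {k δ η σ ε K : ℝ} (hk : 1 < k) (hσ : 0 < σ) (hε : 0 < ε)
    (hεδ : ε ≤ 1 - δ) (hK : 0 < K) {p s : ℕ → ℕ} (hs : ∀ᶠ n in atTop, 1 ≤ s n)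
    (hp : Tendsto p atTop atTop)
    (hsp : (fun n => (s n : ℝ) * Real.log (p n)) =o[atTop] (fun n : ℕ => (n : ℝ)))
    (hδ_lim : Tendsto (fun n => Real.log (s n) / Real.log (p n)) atTop (𝓝 δ))
    (hη_lim : Tendsto (fun n : ℕ => Real.log n / Real.log (p n)) atTop (𝓝 η)) :
    ∀ᶠ n in atTop, GrowthBounds k δ η σ ε K n (p n) (s n) := by
  have hL : Tendsto (fun n => Real.log (p n)) atTop atTop :=
    Real.tendsto_log_atTop.comp (tendsto_natCast_atTop_atTop.comp hp)
  have hk0 : 0 < k := by linarith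
  have hεmin : 0 < min ε 1 := lt_min hε one_pos
  filter_upwards [hs, hsp.bound (by positivity : 0 < 1 / (4 * k)),
    hsp.bound (by positivity : 0 < ε / (4 * (1 + k))),
    hsp.bound (by positivity : 0 < σ ^ 2 / 2 / K), hL.eventually_ge_atTop 1,
    hL.eventually_ge_atTop (Real.log (8 * Real.pi * σ ^ 2) / (2 * ε)),
    hL.eventually_ge_atTop (-Real.log (Real.pi * (σ ^ 2 / 2))),
    hL.eventually_ge_atTop (Real.log (Real.pi * (2 * σ ^ 2))),
    hL.eventually_ge_atTop (Real.log (2 * k) / (ε / 2)), eventually_ge_atTop 8,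
    hp.eventually_gt_atTop 0,
    Metric.tendsto_nhds.1 hδ_lim (ε / 2) (by positivity),
    Metric.tendsto_nhds.1 hη_lim (min ε 1) hεmin] with n hs1 b1 b2 b3 hL1 c1 c2 c3 c4 hn8 hp0 d1 d2
  set L := Real.log (p n) with hLdef
  have hL0 : 0 < L := by linarith
  have hs1' : (1 : ℝ) ≤ s n := by exact_mod_cast hs1
  have hp0' : (0 : ℝ) < p n := by exact_mod_cast hp0
  have hn8' : (8 : ℝ) ≤ n := by exact_mod_cast hn8
  have hsL : 0 ≤ (s n : ℝ) * L := by positivity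
  have hnabs : ‖(n : ℝ)‖ = n := Real.norm_of_nonneg (Nat.cast_nonneg n)
  rw [Real.norm_of_nonneg hsL, hnabs] at b1 b2 b3
  rw [div_mul_eq_mul_div, le_div_iff₀ (by positivity)] at b1 b2 b3
  rw [div_le_iff₀ (by positivity)] at c1 c4
  rw [Real.dist_eq, abs_lt, div_sub' hL0.ne', lt_div_iff₀ hL0, div_lt_iff₀ hL0] at d1 d2
  have hlogs0 : 0 ≤ Real.log (s n) := Real.log_natCast_nonneg _
  have m1 : min ε 1 * L ≤ ε * L := mul_le_mul_of_nonneg_right (min_le_left _ _) hL0.le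
  have m2 : min ε 1 * L ≤ 1 * L := mul_le_mul_of_nonneg_right (min_le_right _ _) hL0.le
  have hlog2k : Real.log (2 * k) = Real.log 2 + Real.log k :=
    Real.log_mul (by norm_num) hk0.ne'
  -- log s ≤ (δ + ε/2)L and log(2k) ≤ (ε/2)L add up to at most L because ε ≤ 1 - δ. Hence p - i ≥
  -- p/2 in the range of i below.
  have hsp2 : 2 * (k * s n) ≤ p n := by
    rw [← Real.log_le_log_iff (by positivity) hp0', ← mul_assoc,
      Real.log_mul (by positivity) (by positivity)]
    have := mul_le_mul_of_nonneg_right hεδ hL0.le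
    linarith [d1.2]
  refine ⟨hL0, hs1, ?_, by linarith, by linarith, by linarith [d2.1], ?_, by linarith,
    by linarith, c3, ?_⟩
  · have : (s n : ℝ) * 1 ≤ s n * L := mul_le_mul_of_nonneg_left hL1 (by linarith)
    have := mul_le_mul_of_nonneg_left this hk0.le
    linarith
  · have := mul_le_mul_of_nonneg_right (le_abs_self η) hL0.le
    linarith [d2.2]
  · intro i hi1 hi2
    have hi1' : (s n : ℝ) ≤ i := by exact_mod_cast hi1
    have hi0 : (0 : ℝ) ≤ i := Nat.cast_nonneg i
    have u1 : Real.log ((p n : ℝ) - i) ≤ L := Real.log_le_log (by linarith) (by linarith)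
    have u2 : Real.log (s n) ≤ Real.log ((i : ℝ) + 1) :=
      Real.log_le_log (by linarith) (by linarith)
    have l1 : L - Real.log 2 ≤ Real.log ((p n : ℝ) - i) := by
      rw [← Real.log_div hp0'.ne' (by norm_num)]
      exact Real.log_le_log (by positivity) (by linarith)
    have l2 : Real.log ((i : ℝ) + 1) ≤ Real.log k + Real.log (s n) := by
      rw [← Real.log_mul hk0.ne' (by positivity)]
      exact Real.log_le_log (by positivity) hi2
    have := mul_pos hε hL0
    constructor
    · linarith [d1.2]
    · linarith [d1.1]

/-! ### Convergence in probability -/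

section Probability

variable {Ω : Type*} [MeasurableSpace Ω] {P : Measure Ω}

theorem tendstoInMeasure_of_abs_sub_le {f : ℕ → Ω → ℝ} {a : ℝ} {B : ℕ → Set Ω} {τ : ℕ → ℝ}
    (hB : Tendsto (fun n => P (B n)) atTop (𝓝 0)) (hτ : Tendsto τ atTop (𝓝 0))
    (h : ∀ᶠ n in atTop, ∀ ω ∉ B n, |f n ω - a| ≤ τ n) :
    TendstoInMeasure P f atTop (fun _ => a) := by
  rw [tendstoInMeasure_iff_dist]
  intro ε hε
  refine tendsto_of_tendsto_of_tendsto_of_le_of_le' tendsto_const_nhds hB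
    (Eventually.of_forall fun _ => zero_le) ?_
  filter_upwards [h, hτ.eventually_lt_const hε] with n hn hτn
  refine measure_mono fun ω hω => ?_
  by_contra hcon
  have h1 : ε ≤ |f n ω - a| := hω
  linarith [hn ω hcon]

theorem tendsto_measure_one_of_compl [IsProbabilityMeasure P] {B S : ℕ → Set Ω}
    (hB : Tendsto (fun n => P (B n)) atTop (𝓝 0)) (h : ∀ᶠ n in atTop, (B n)ᶜ ⊆ S n) :
    Tendsto (fun n => P (S n)) atTop (𝓝 1) := by
  have h1 : Tendsto (fun n => 1 - P (B n)) atTop (𝓝 1) := by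
    simpa using ENNReal.Tendsto.sub tendsto_const_nhds hB (Or.inl ENNReal.one_ne_top)
  refine tendsto_of_tendsto_of_tendsto_of_le_of_le' h1 tendsto_const_nhds ?_
    (Eventually.of_forall fun _ => prob_le_one)
  filter_upwards [h] with n hn
  rw [tsub_le_iff_right, ← measure_univ (μ := P)]
  refine (measure_mono fun ω _ => ?_).trans (measure_union_le (S n) (B n))
  by_cases hω : ω ∈ B n
  · exact Or.inr hω
  · exact Or.inl (hn hω)

/-- Passing to the complement needs measurability of the event, which is a finite union of level
sets of C. -/
theorem ScreeningCondition.tendsto_notMem [IsProbabilityMeasure P] {k : ℝ} {p : ℕ → ℕ}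
    {M₀ : ∀ n, Finset (Fin (p n))} {C : ∀ n, Ω → Finset (Finset (Fin (p n)))}
    (hC : ScreeningCondition P k p M₀ C) :
    Tendsto (fun n => P {ω | M₀ n ∉ C n ω}) atTop (𝓝 0) := by
  have hm (n : ℕ) : MeasurableSet {ω | M₀ n ∈ C n ω} := by
    have : {ω | M₀ n ∈ C n ω} = ⋃ D ∈ {D : Finset (Finset (Fin (p n))) | M₀ n ∈ D},
        {ω | C n ω = D} := by
      ext ω; simp
    rw [this]
    exact MeasurableSet.biUnion (Set.to_countable _) fun D _ => hC.measurable n D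
  have h := ENNReal.Tendsto.sub (tendsto_const_nhds (x := (1 : ENNReal))) hC.mem_true
    (Or.inl ENNReal.one_ne_top)
  simp only [tsub_self] at h
  refine h.congr fun n => ?_
  rw [← prob_compl_eq_one_sub (hm n)]
  rfl

end Probability

section Ratio

variable {n p : ℕ} {X : Matrix (Fin n) (Fin p) ℝ} {y : EuclideanSpace ℝ (Fin n)} {k γ τ : ℝ}
  {M₀ : Finset (Fin p)}

theorem maxRatio_mem_Icc (hτ : 0 ≤ τ) (hpos : ∀ M ∈ modelClass k M₀, 0 < weight γ X y M)
    (hpos₀ : 0 < weight γ X y M₀)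
    (h : ∀ M ∈ modelClass k M₀, M ≠ M₀ → weight γ X y M / weight γ X y M₀ ≤ τ) :
    0 ≤ maxRatio k γ X y M₀ ∧ maxRatio k γ X y M₀ ≤ τ := by
  constructor
  · apply Real.sSup_nonneg
    rintro _ ⟨M, hM, -, rfl⟩
    exact (div_pos (hpos M hM) hpos₀).le
  -- Nonnegativity of τ covers an empty set of competitors, whose `sSup` is 0 by convention.
  · apply Real.sSup_le _ hτ
    rintro _ ⟨M, hM, hne, rfl⟩
    exact h M hM hne

/-- With a the weight of M₀ and S that of its competitors, 1 - a/(a+S) = S/(a+S) ≤ S/a. -/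
theorem abs_fidProb_sub_one_le {C : Finset (Finset (Fin p))} (hM₀ : M₀ ∈ C)
    (hpos : ∀ M ∈ C, 0 < weight γ X y M)
    (h : ∑ M ∈ C.erase M₀, weight γ X y M / weight γ X y M₀ ≤ τ) :
    |fidProb γ X y C M₀ - 1| ≤ τ := by
  have h0 := hpos M₀ hM₀
  have hS0 : 0 ≤ ∑ M ∈ C.erase M₀, weight γ X y M :=
    Finset.sum_nonneg fun M hM => (hpos M (Finset.mem_of_mem_erase hM)).le
  rw [← Finset.sum_div] at h
  rw [fidProb, if_pos hM₀, ← Finset.add_sum_erase _ _ hM₀]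
  generalize weight γ X y M₀ = a at *
  generalize ∑ M ∈ C.erase M₀, weight γ X y M = S at *
  have haS : 0 < a + S := by linarith
  rw [div_sub_one haS.ne', abs_div, abs_of_pos haS, sub_add_cancel_left, abs_neg,
    abs_of_nonneg hS0]
  exact (div_le_div_of_nonneg_left hS0 h0 (by linarith)).trans h

end Ratio

/-- Consistency of the generalized fiducial distribution when
`γ (1 - δ) > 1 - η / 2`. -/
theorem consistent_of_lt {Ω : Type*} [MeasurableSpace Ω] (P : Measure Ω) [IsProbabilityMeasure P]
    {k δ η σ γ : ℝ} (hk : 1 < k) (hδ : δ < 1) (hσ : 0 < σ) (hγ : 1 - η / 2 < γ * (1 - δ))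
    (p : ℕ → ℕ) (X : ∀ n, Matrix (Fin n) (Fin (p n)) ℝ) (β : ∀ n, Fin (p n) → ℝ)
    (Z : ∀ n, Fin n → Ω → ℝ) (hZ_law : ∀ n i, HasLaw (Z n i) (gaussianReal 0 1) P)
    (hZ_indep : ∀ n, iIndepFun (Z n) P) (hM₀ : ∀ᶠ n in atTop, (trueModel (β n)).Nonempty)
    (hid : Tendsto (fun n => idGap k (X n) (β n)) atTop atTop)
    (hp : Tendsto p atTop atTop)
    (hM₀p : (fun n => ((trueModel (β n)).card : ℝ) * Real.log (p n))
      =o[atTop] (fun n : ℕ => (n : ℝ)))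
    (hδ_lim : Tendsto (fun n => Real.log (trueModel (β n)).card / Real.log (p n)) atTop (𝓝 δ))
    (hη_lim : Tendsto (fun n : ℕ => Real.log n / Real.log (p n)) atTop (𝓝 η)) :
    Consistent P k γ p X (fun n => trueModel (β n))
      (fun n ω => response (X n) (β n) σ (fun i => Z n i ω)) := by
  obtain ⟨ε, hε, hε', hεδ, hεγ⟩ : ∃ ε : ℝ, 0 < ε ∧ ε ≤ 1 / 10 ∧ ε ≤ 1 - δ ∧
      (9 + |γ|) * ε ≤ γ * (1 - δ) + η / 2 - 1 := by
    have hγ0 : 0 < 9 + |γ| := by positivity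
    refine ⟨min (1 / 10) (min (1 - δ) ((γ * (1 - δ) + η / 2 - 1) / (9 + |γ|))), ?_,
      min_le_left _ _, (min_le_right _ _).trans (min_le_left _ _), ?_⟩
    · exact lt_min (by norm_num) (lt_min (by linarith) (div_pos (by linarith) hγ0))
    · rw [mul_comm, ← le_div_iff₀ hγ0]
      exact (min_le_right _ _).trans (min_le_right _ _)
  obtain ⟨K, hK⟩ : ∃ K, K = 16 * σ ^ 2 * (k * (2 * (|η| + 1) + 1 + |γ|) + k + 2) := ⟨_, rfl⟩
  have hK0 : 0 < K := by rw [hK]; positivity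
  set y : ∀ n, Ω → EuclideanSpace ℝ (Fin n) :=
    fun n ω => response (X n) (β n) σ (fun i => Z n i ω) with hy
  set τ : ℕ → ℝ := fun n =>
    Real.exp (-(ε * Real.log (p n))) + Real.exp (1 - 2 * Real.log (p n)) with hτdef
  have hL : Tendsto (fun n => Real.log (p n)) atTop atTop :=
    Real.tendsto_log_atTop.comp (tendsto_natCast_atTop_atTop.comp hp)
  have hτ : Tendsto τ atTop (𝓝 0) := by
    have t1 : Tendsto (fun n => Real.exp (-(ε * Real.log (p n)))) atTop (𝓝 0) :=
      Real.tendsto_exp_neg_atTop_nhds_zero.comp (hL.const_mul_atTop hε)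
    have t2 : Tendsto (fun n => Real.exp (1 - 2 * Real.log (p n))) atTop (𝓝 0) := by
      refine Real.tendsto_exp_atBot.comp ?_
      exact tendsto_atBot_add_const_left _ 1
        (tendsto_neg_atTop_atBot.comp (hL.const_mul_atTop two_pos))
    simpa using t1.add t2
  have hτ0 (n : ℕ) : 0 ≤ τ n := by positivity
  set B : ℕ → Set Ω :=
    fun n => {ω | ¬ GoodNoise (X n) (β n) ε (WithLp.toLp 2 fun i => Z n i ω)} with hBdef
  have hB : Tendsto (fun n => P (B n)) atTop (𝓝 0) := by
    refine tendsto_of_tendsto_of_tendsto_of_le_of_le tendsto_const_nhds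
      (tendsto_stdGaussian_not_goodNoise hp X β hε (by linarith)) (fun _ => zero_le) fun n => ?_
    have hlaw := (hZ_indep n).hasLaw_pi (hZ_law n)
    have hae : AEMeasurable (fun ω => (WithLp.toLp 2 fun i => Z n i ω :
        EuclideanSpace ℝ (Fin n))) P :=
      AEMeasurable.comp_aemeasurable (by fun_prop) hlaw.aemeasurable
    rw [← map_pi_eq_stdGaussian, ← hlaw.map_eq, AEMeasurable.map_map_of_aemeasurable
      (by fun_prop) hlaw.aemeasurable]
    -- Only this inequality is needed, so the bad event need not be shown measurable.
    exact Measure.le_map_apply hae _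
  have hgood : ∀ᶠ n in atTop, ∀ ω ∉ B n,
      (∀ M ∈ modelClass k (trueModel (β n)), 0 < weight γ (X n) (y n ω) M) ∧
      ∀ C : Finset (Finset (Fin (p n))),
        (∀ M ∈ C, M ∈ modelClass k (trueModel (β n)) ∧ M ≠ trueModel (β n)) →
        ∑ M ∈ C, weight γ (X n) (y n ω) M / weight γ (X n) (y n ω) (trueModel (β n)) ≤ τ n := by
    filter_upwards [eventually_growthBounds hk hσ hε hεδ hK0
      (hM₀.mono fun n hn => Finset.card_pos.2 hn) hp hM₀p hδ_lim hη_lim,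
      hid.eventually_ge_atTop (2 * K + 24 * σ ^ 2 * (1 + k))] with n hg hidn ω hω
    have hz := not_not.1 hω
    exact ⟨fun M hM => weight_pos_of_mem hσ hk hε' hK0.le hg hz hidn hM,
      fun C hC => sum_weight_div_le hσ hk hε hε' hεγ hK hg hz hidn C hC⟩
  have hmem (n : ℕ) := mem_modelClass_self hk.le (trueModel (β n))
  refine ⟨tendstoInMeasure_of_abs_sub_le hB hτ ?_, fun C hC => ⟨?_, ?_⟩⟩
  · filter_upwards [hgood] with n hn ω hω
    obtain ⟨h1, h2⟩ := hn ω hω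
    -- Applying the sum bound to singletons controls each ratio by the same τ.
    have h3 := maxRatio_mem_Icc (hτ0 n) h1 (h1 _ (hmem n)) fun M hM hne => by
      simpa using h2 {M} (by simpa using ⟨hM, hne⟩)
    rw [sub_zero, abs_of_nonneg h3.1]
    exact h3.2
  · have hB' := hB.add hC.tendsto_notMem
    rw [add_zero] at hB'
    refine tendstoInMeasure_of_abs_sub_le (B := fun n => B n ∪ {ω | trueModel (β n) ∉ C n ω})
      (tendsto_of_tendsto_of_tendsto_of_le_of_le tendsto_const_nhds hB' (fun _ => zero_le)
        fun n => measure_union_le _ _) hτ ?_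
    filter_upwards [hgood] with n hn ω hω
    rw [Set.mem_union, not_or] at hω
    obtain ⟨h1, h2⟩ := hn ω hω.1
    refine abs_fidProb_sub_one_le (not_not.1 hω.2) (fun M hM => h1 M (hC.size_le n ω M hM))
      (h2 _ fun M hM => ?_)
    exact ⟨hC.size_le n ω M (Finset.mem_of_mem_erase hM), Finset.ne_of_mem_erase hM⟩
  · have hB' := hB.add hC.tendsto_notMem
    rw [add_zero] at hB'
    refine tendsto_measure_one_of_compl (B := fun n => B n ∪ {ω | trueModel (β n) ∉ C n ω})
      (tendsto_of_tendsto_of_tendsto_of_le_of_le tendsto_const_nhds hB' (fun _ => zero_le)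
        fun n => measure_union_le _ _) ?_
    filter_upwards [hgood, hτ.eventually_lt_const one_pos] with n hn hτn ω hω
    rw [Set.mem_compl_iff, Set.mem_union, not_or] at hω
    obtain ⟨h1, h2⟩ := hn ω hω.1
    refine ⟨not_not.1 hω.2, fun M hM hne => ?_⟩
    have h3 := h2 {M} (by simpa using ⟨hC.size_le n ω M hM, hne⟩)
    rw [Finset.sum_singleton] at h3
    exact (div_lt_one (h1 _ (hmem n))).1 (h3.trans_lt hτn)

end Fiducial

/-! ### The two ranges of γ -/

theorem theorem1 {Ω : Type*} [MeasurableSpace Ω] (P : Measure Ω) [IsProbabilityMeasure P]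
    (k δ η σ : ℝ) (hk : 1 < k) (hδ : δ < 1) (hσ : 0 < σ)
    (p : ℕ → ℕ) (X : ∀ n, Matrix (Fin n) (Fin (p n)) ℝ) (β : ∀ n, Fin (p n) → ℝ)
    (Z : ∀ n, Fin n → Ω → ℝ)
    -- the errors are `σ` times i.i.d. standard normal variables
    (hZ_law : ∀ n i, HasLaw (Z n i) (gaussianReal 0 1) P)
    (hZ_indep : ∀ n, iIndepFun (Z n) P)
    (hM₀ : ∀ᶠ n in atTop, (Fiducial.trueModel (β n)).Nonempty)
    -- the identifiability condition
    (hid : Tendsto (fun n => Fiducial.idGap k (X n) (β n)) atTop atTop)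
    -- the growth conditions
    (hp : Tendsto p atTop atTop)
    (hM₀p : (fun n => ((Fiducial.trueModel (β n)).card : ℝ) * Real.log (p n))
      =o[atTop] (fun n : ℕ => (n : ℝ)))
    (hδ_lim : Tendsto (fun n => Real.log (Fiducial.trueModel (β n)).card / Real.log (p n))
      atTop (𝓝 δ))
    (hη_lim : Tendsto (fun n : ℕ => Real.log n / Real.log (p n)) atTop (𝓝 η)) :
    (∃ γ : ℝ, (1 + δ) / (1 - δ) - 3 * η / (2 * (1 - δ)) < γ ∧
      Fiducial.Consistent P k γ p X (fun n => Fiducial.trueModel (β n))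
        (fun n ω => Fiducial.response (X n) (β n) σ (fun i => Z n i ω))) ∧
    (∀ γ : ℝ, (1 + δ) / (1 - δ) - η / (2 * (1 - δ)) < γ →
      Fiducial.Consistent P k γ p X (fun n => Fiducial.trueModel (β n))
        (fun n ω => Fiducial.response (X n) (β n) σ (fun i => Z n i ω))) := by
  have hδ1 : 0 < 1 - δ := by linarith
  -- With δ ≥ 0, the assumed γ(1-δ) > 1 + δ - η/2 implies the weaker requirement γ(1-δ) > 1 - η/2.
  have hδ0 : 0 ≤ δ := ge_of_tendsto' hδ_lim fun n =>
    div_nonneg (Real.log_natCast_nonneg _) (Real.log_natCast_nonneg _)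
  have hη0 : 0 ≤ η := ge_of_tendsto' hη_lim fun n =>
    div_nonneg (Real.log_natCast_nonneg _) (Real.log_natCast_nonneg _)
  have hcons : ∀ γ : ℝ, (1 + δ) / (1 - δ) - η / (2 * (1 - δ)) < γ →
      Fiducial.Consistent P k γ p X (fun n => Fiducial.trueModel (β n))
        (fun n ω => Fiducial.response (X n) (β n) σ (fun i => Z n i ω)) := by
    intro γ hγ
    refine Fiducial.consistent_of_lt P hk hδ hσ ?_ p X β Z hZ_law hZ_indep hM₀ hid hp hM₀p hδ_lim
      hη_lim
    rw [show (1 + δ) / (1 - δ) - η / (2 * (1 - δ)) = (1 + δ - η / 2) / (1 - δ) by field_simp,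
      div_lt_iff₀ hδ1] at hγ
    linarith
  -- Since η ≥ 0, the threshold with 3η is the lower one, so any γ beyond the threshold with η is a
  -- witness.
  refine ⟨⟨(1 + δ) / (1 - δ) - η / (2 * (1 - δ)) + 1, ?_, hcons _ (by linarith)⟩, hcons⟩
  have : η / (2 * (1 - δ)) ≤ 3 * η / (2 * (1 - δ)) := by gcongr; linarith
  linarith
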